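/- Let $\mathcal H$ be a complex Hilbert space and let $\pi$ be a strongly continuous unitary representation of $\mathrm U(1)$ on $\mathcal H$. Let $X$ be its charge operator, i.e. the selfadjoint operator with $\pi(e^{i\alpha})=\exp(i\alpha X)$ for $\alpha\in\mathbb R$; its spectrum is pure point and contained in $\mathbb Z$. For $\mu\in\mathbb Z$ let $\mathcal H^{(\mu)}=\ker(X-\mu)$ (possibly zero), let $X^{(\mu)}$ be the orthogonal projection onto $\mathcal H^{(\mu)}$, and write $\psi^{(\mu)}=X^{(\mu)}\psi$. Assume that every $\mathcal H^{(\mu)}$ is finite-dimensional. Put $$D_X=\{\psi\in\mathcal H : X^{(\mu)}\psi=0 \text{ for all but finitely many } \mu\}.$$ A (possibly unbounded) selfadjoint operator $H$ is said to commute with $X$ if its spectral projections commute with all $X^{(\mu)}$. Let $\mathfrak u(X)=\{iH : H=H^*\text{ commuting with }X\}$. For $Q\in\mathfrak u(X)$ let $t\mapsto\exp(tQ)$ denote the strongly continuous one-parameter unitary group with generator $Q$. All topological notions for sets of unitaries refer to the strong operator topology on the unitary group $\mathcal U(\mathcal H)$. Then: 1. Every selfadjoint $H$ commuting with $X$ has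 $D_X$ as an invariant domain of essential selfadjointness: $D_X\subset D(H)$, $HD_X\subset D_X$, and $H$ is the closure of its restriction to $D_X$. The set $\mathfrak u(X)$ is a real Lie algebra, where $\lambda Q_1+Q_2$ and $[Q_1,Q_2]$ are the elements of $\mathfrak u(X)$ given on $\psi\in D_X$ by $\lambda Q_1\psi+Q_2\psi$ and $Q_1Q_2\psi-Q_2Q_1\psi$. Moreover, for every $iH\in\mathfrak u(X)$ there are selfadjoint operators $H^{(\mu)}\in\mathcal B(\mathcal H^{(\mu)})$ with $H\psi=\sum_\mu H^{(\mu)}\psi^{(\mu)}$ for $\psi\in D_X$, and every family $(H^{(\mu)})_{\mu\in\mathbb Z}$ of selfadjoint operators arises in this way from exactly one $iH\in\mathfrak u(X)$. 2. The exponential map is well defined on $\mathfrak u(X)$ (each $Q\in\mathfrak u(X)$ generates exactly one strongly continuous one-parameter unitary group), and $\exp(iH)\psi=\sum_\mu\exp(iH^{(\mu)})\psi^{(\mu)}$ for all $\psi\in\mathcal H$. It maps $\mathfrak u(X)$ onto the subgroup $$\mathcal U(X)=\{U\in\mathcal U(\mathcal H) : [U,\pi(z)]=0\text{ for all }z\in\mathrm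 U(1)\},$$ which is strongly closed in $\mathcal U(\mathcal H)$. For every $U\in\mathcal U(X)$ there are unitaries $U^{(\mu)}$ on $\mathcal H^{(\mu)}$ with $U\psi=\sum_\mu U^{(\mu)}\psi^{(\mu)}$ for all $\psi\in\mathcal H$, and every family $(U^{(\mu)})_{\mu\in\mathbb Z}$ of such unitaries arises in this way from exactly one $U\in\mathcal U(X)$. 3. Let $iH_1,\dots,iH_d\in\mathfrak u(X)$, let $\mathfrak l\subset\mathfrak u(X)$ be the Lie subalgebra generated by them, and let the dynamical group $\mathcal G$ be the smallest strongly closed subgroup of $\mathcal U(\mathcal H)$ that contains $\exp(itH_k)$ for all $k\in\{1,\dots,d\}$ and $t\in\mathbb R$. Then $\exp(\mathfrak l)\subset\mathcal G$, and the strong closure of $\exp(\mathfrak l)$ in $\mathcal U(\mathcal H)$ is $\mathcal G$. -/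

import Mathlib

open MeasureTheory Topology
open scoped ENNReal InnerProductSpace

noncomputable section

namespace ChargeControl

variable {𝓗 : Type*} [NormedAddCommGroup 𝓗] [InnerProductSpace ℂ 𝓗] [CompleteSpace 𝓗]

/-! ### Unitaries and the strong operator topology -/

/-- The exponential series of a bounded operator on a Hilbert space. -/
def boundedExp {K : Type*} [NormedAddCommGroup K] [InnerProductSpace ℂ K] (h : K →L[ℂ] K) :
    K →L[ℂ] K := NormedSpace.exp h

/-- The strong operator topology on the group of unitaries: the topology of pointwise
convergence on vectors, restricted from bounded operators to unitaries. -/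
@[reducible] def strongTopology (𝓗 : Type*) [NormedAddCommGroup 𝓗] [InnerProductSpace ℂ 𝓗]
    [CompleteSpace 𝓗] : TopologicalSpace (unitary (𝓗 →L[ℂ] 𝓗)) :=
  TopologicalSpace.induced
    (fun U => ContinuousLinearMap.toPointwiseConvergenceCLM ℂ (RingHom.id ℂ) 𝓗 𝓗
      (U : 𝓗 →L[ℂ] 𝓗))
    inferInstance

/-! ### Generators and exponentials -/

/-- The infinitesimal generator of a family `V : ℝ → unitaries`: its domain consists of the `ψ`
for which `t ↦ V t ψ` is differentiable at `0`, and it maps `ψ` to that derivative. -/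
def generator (V : ℝ → unitary (𝓗 →L[ℂ] 𝓗)) : 𝓗 →ₗ.[ℂ] 𝓗 where
  domain :=
    { carrier := {ψ | DifferentiableAt ℝ (fun t : ℝ => (V t : 𝓗 →L[ℂ] 𝓗) ψ) 0}
      add_mem' := fun {a b} ha hb => by
        simp only [Set.mem_ofPred_eq, map_add] at ha hb ⊢
        exact ha.add hb
      zero_mem' := by simp
      smul_mem' := fun c a ha => by
        simp only [Set.mem_ofPred_eq, map_smul] at ha ⊢
        exact ha.const_smul c }
  toFun :=
    { toFun := fun ψ => deriv (fun t : ℝ => (V t : 𝓗 →L[ℂ] 𝓗) (ψ : 𝓗)) 0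
      map_add' := fun a b => by
        simp only [Submodule.coe_add, map_add]
        exact deriv_add a.2 b.2
      map_smul' := fun c a => by
        simp only [Submodule.coe_smul, map_smul, RingHom.id_apply]
        exact deriv_const_smul c a.2 }

/-- Strongly continuous one-parameter groups of unitaries. -/
structure IsUnitaryGroup (V : ℝ → unitary (𝓗 →L[ℂ] 𝓗)) : Prop where
  map_zero : V 0 = 1
  map_add : ∀ s t, V (s + t) = V s * V t
  continuous : ∀ ψ : 𝓗, Continuous fun t => (V t : 𝓗 →L[ℂ] 𝓗) ψ

open Classical in
/-- `expGroup A t` is `exp (t A)` for an anti-selfadjoint operator `A`: the one-parameter unitary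
group with generator `A` (the default value `1` is used if there is no such group). -/
def expGroup (A : 𝓗 →ₗ.[ℂ] 𝓗) : ℝ → unitary (𝓗 →L[ℂ] 𝓗) :=
  if h : ∃ V : ℝ → unitary (𝓗 →L[ℂ] 𝓗), IsUnitaryGroup V ∧ generator V = A then h.choose else 1

/-- The exponential `exp A` of an anti-selfadjoint operator `A`. -/
def expOp (A : 𝓗 →ₗ.[ℂ] 𝓗) : unitary (𝓗 →L[ℂ] 𝓗) := expGroup A 1

/-- The dynamical group of the control problem with generators `A k = i H k`: the smallest strongly
closed group of unitaries that contains all `exp (t A k)`. -/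
def dynamicalGroup {ι : Type*} (A : ι → 𝓗 →ₗ.[ℂ] 𝓗) : Subgroup (unitary (𝓗 →L[ℂ] 𝓗)) :=
  sInf {G | IsClosed[strongTopology 𝓗] (G : Set (unitary (𝓗 →L[ℂ] 𝓗))) ∧
    ∀ k t, expGroup (A k) t ∈ G}

/-! ### Spectral measures -/

variable (𝓗) in
/-- Projection-valued measures on the Borel sets of `ℝ` (the values on other sets are
irrelevant). -/
structure SpectralMeasure where
  proj : Set ℝ → 𝓗 →L[ℂ] 𝓗
  isStarProjection : ∀ B, MeasurableSet B → IsStarProjection (proj B)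
  proj_empty : proj ∅ = 0
  proj_univ : proj Set.univ = 1
  proj_inter : ∀ B C, MeasurableSet B → MeasurableSet C → proj (B ∩ C) = proj B * proj C
  hasSum_iUnion : ∀ B : ℕ → Set ℝ, (∀ n, MeasurableSet (B n)) →
    Pairwise (Function.onFun Disjoint B) →
      ∀ ψ, HasSum (fun n => proj (B n) ψ) (proj (⋃ n, B n) ψ)

namespace SpectralMeasure

theorem normSq_eq (E : SpectralMeasure 𝓗) (ψ : 𝓗) {B : Set ℝ} (hB : MeasurableSet B) :
    ‖E.proj B ψ‖ ^ 2 = (⟪ψ, E.proj B ψ⟫_ℂ).re := by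
  have h := E.isStarProjection B hB
  have h1 : E.proj B (E.proj B ψ) = E.proj B ψ := by
    have := h.isIdempotentElem
    exact congrArg (fun T : 𝓗 →L[ℂ] 𝓗 => T ψ) this
  have h2 : ⟪E.proj B ψ, E.proj B ψ⟫_ℂ = ⟪ψ, E.proj B (E.proj B ψ)⟫_ℂ := by
    have := (ContinuousLinearMap.isSelfAdjoint_iff_isSymmetric.mp h.isSelfAdjoint)
    exact this ψ (E.proj B ψ)
  rw [h1] at h2
  rw [← h2, ← inner_self_eq_norm_sq (𝕜 := ℂ)]
  rfl

/-- The finite Borel measure `B ↦ ⟪ψ, E(B) ψ⟫ = ‖E(B) ψ‖²`. -/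
def scalarMeasure (E : SpectralMeasure 𝓗) (ψ : 𝓗) : Measure ℝ :=
  Measure.ofMeasurable (fun B _ => ENNReal.ofReal (‖E.proj B ψ‖ ^ 2))
    (by simp [E.proj_empty])
    (by
      intro B hB hd
      have hs : HasSum (fun n => ‖E.proj (B n) ψ‖ ^ 2) (‖E.proj (⋃ n, B n) ψ‖ ^ 2) := by
        have h := (Complex.reCLM.hasSum
          ((innerSL ℂ ψ).hasSum (E.hasSum_iUnion B hB hd ψ)))
        rw [E.normSq_eq ψ (MeasurableSet.iUnion hB)]
        simp only [fun n => E.normSq_eq ψ (hB n)]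
        exact h
      rw [← hs.tsum_eq, ENNReal.ofReal_tsum_of_nonneg (fun n => by positivity) hs.summable])

/-- `E` is the spectral measure of `T`, that is `T = ∫ x dE(x)` with domain
`{ψ | ∫ x² d⟪ψ, E(x) ψ⟫ < ∞}`. The quadratic form determines the values of `T` by
polarization. -/
def IsSpectralMeasureOf (E : SpectralMeasure 𝓗) (T : 𝓗 →ₗ.[ℂ] 𝓗) : Prop :=
  (∀ ψ, ψ ∈ T.domain ↔ ∫⁻ x, ENNReal.ofReal (x ^ 2) ∂(E.scalarMeasure ψ) < ∞) ∧
    ∀ ψ : T.domain, ⟪(ψ : 𝓗), T ψ⟫_ℂ = ((∫ x, x ∂(E.scalarMeasure (ψ : 𝓗)) : ℝ) : ℂ)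

end SpectralMeasure

/-! ### The charge operator and the operators commuting with it -/

/-- The charge operator `X` of a representation `π` of `U(1)`, i.e. the operator with
`π (e^{iα}) = exp (i α X)`. -/
def chargeOperator (π : Circle →* unitary (𝓗 →L[ℂ] 𝓗)) : 𝓗 →ₗ.[ℂ] 𝓗 :=
  (-Complex.I) • generator fun α : ℝ => π (Circle.exp α)

/-- The eigenspace of `X` for `μ ∈ ℤ`; it is zero if `μ` is not an eigenvalue. -/
def chargeSpace (π : Circle →* unitary (𝓗 →L[ℂ] 𝓗)) (μ : ℤ) : Submodule ℂ 𝓗 where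
  carrier := {ψ | ∃ h : ψ ∈ (chargeOperator π).domain, chargeOperator π ⟨ψ, h⟩ = (μ : ℂ) • ψ}
  add_mem' := by
    rintro a b ⟨ha, ha'⟩ ⟨hb, hb'⟩
    refine ⟨add_mem ha hb, ?_⟩
    have := (chargeOperator π).map_add ⟨a, ha⟩ ⟨b, hb⟩
    rw [ha', hb', ← smul_add] at this
    exact this
  zero_mem' := ⟨zero_mem _, by
    have := (chargeOperator π).map_zero
    rw [smul_zero]
    exact this⟩
  smul_mem' := by
    rintro c a ⟨ha, ha'⟩
    refine ⟨Submodule.smul_mem _ c ha, ?_⟩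
    have := (chargeOperator π).map_smul c ⟨a, ha⟩
    rw [ha', smul_comm] at this
    exact this

variable (π : Circle →* unitary (𝓗 →L[ℂ] 𝓗)) [∀ μ : ℤ, FiniteDimensional ℂ (chargeSpace π μ)]

/-- The component `ψ^(μ) = X^(μ) ψ` of `ψ` in the eigenspace, as an element of that eigenspace. -/
def component (μ : ℤ) : 𝓗 →L[ℂ] chargeSpace π μ := (chargeSpace π μ).orthogonalProjectionOnto

/-- The eigenprojection `X^(μ)` as an operator on the whole space. -/
def chargeProj (μ : ℤ) : 𝓗 →L[ℂ] 𝓗 := (chargeSpace π μ).starProjection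

/-- The space `D_X` of finite particle vectors. -/
def finiteParticle : Submodule ℂ 𝓗 where
  carrier := {ψ | {μ : ℤ | chargeProj π μ ψ ≠ 0}.Finite}
  add_mem' := fun {a b} ha hb => (ha.union hb).subset fun μ hμ => by
    by_contra hc
    simp only [Set.mem_union, Set.mem_ofPred_eq, not_or, not_not] at hc
    exact hμ (by rw [map_add, hc.1, hc.2, add_zero])
  zero_mem' := by simp
  smul_mem' := fun c a ha => ha.subset fun μ hμ hc => hμ (by rw [map_smul, hc, smul_zero])

/-- `T` commutes with `X`: the spectral projections of `T` commute with the
eigenprojections of `X`. -/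
def CommutesWithCharge (T : 𝓗 →ₗ.[ℂ] 𝓗) : Prop :=
  ∃ E : SpectralMeasure 𝓗, E.IsSpectralMeasureOf T ∧
    ∀ B, MeasurableSet B → ∀ μ : ℤ, Commute (E.proj B) (chargeProj π μ)

/-- `𝔲(X)`, the set of all `i T` with `T` selfadjoint and commuting with `X`. -/
def chargeAlgebra : Set (𝓗 →ₗ.[ℂ] 𝓗) :=
  {A | ∃ T : 𝓗 →ₗ.[ℂ] 𝓗, IsSelfAdjoint T ∧ CommutesWithCharge π T ∧ A = Complex.I • T}

/-- `𝒰(X)`, the group of all unitaries commuting with all `π z`. -/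
def chargeGroup : Subgroup (unitary (𝓗 →L[ℂ] 𝓗)) := Subgroup.centralizer (Set.range π)

end ChargeControl

end

open ChargeControl

/-!
The Fourier coefficients of `z ↦ π z ψ` show that the charge eigenspaces form a Hilbert sum. An
operator commuting with the charge is block diagonal with respect to it, and since the blocks are
finite-dimensional it is diagonal in a Hilbert basis of eigenvectors. Selfadjointness, the core
property and the one-parameter group are then read off coordinatewise, and `𝔲(X)` becomes the Lie
algebra of all families of skew-adjoint blocks. Block-diagonal unitaries form a closed embedding of
the product of the unitary groups of the blocks, with its product topology, into the unitary group
with the strong topology, so the dynamical group can be computed in that product.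

What remains is that for a Lie algebra `𝔩` of families of skew-adjoint elements the closure of
`exp 𝔩` is a group containing `exp 𝔩` and contained in every closed group that contains the
one-parameter groups of a generating set. The second inclusion is the Lie–Trotter formula. For the
group property only finitely many blocks matter at a time. There the trace form is invariant under
conjugation by `u = exp a`, so `b ∈ 𝔩` splits as a sum of an element commuting with `u` and a
coboundary `y - u⁻¹ y u`, the latter being the velocity of a path of conjugates of `u`. Thus, to
first order, `exp a * exp (t b)` is again an exponential, with an exponent whose norm can be kept
bounded; iterating with small steps and passing to the limit by compactness reaches
`exp a * exp b`.
-/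

noncomputable section

namespace ChargeControl

open Filter
open NormedSpace (exp)

attribute [local instance] LieRing.ofAssociativeRing

/-! ### Exponentials in Banach algebras -/

section BanachAlgebra

theorem exp_apply_mem {E : Type*} [NormedAddCommGroup E] [NormedSpace ℝ E] [CompleteSpace E]
    {T : E →L[ℝ] E} {S : Submodule ℝ E} (hS : IsClosed (S : Set E)) (hT : ∀ x ∈ S, T x ∈ S)
    {x : E} (hx : x ∈ S) : exp T x ∈ S := by
  have hpow : ∀ n : ℕ, (T ^ n) x ∈ S := by
    intro n
    induction n with
    | zero => simpa
    | succ n ih =>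
      rw [pow_succ', mul_apply_eq_comp]
      exact hT _ ih
  have hsum := (NormedSpace.exp_series_hasSum_exp' (𝕂 := ℝ) T).mapL (.apply ℝ E x)
  exact hS.mem_of_tendsto hsum <| .of_forall fun s =>
    S.sum_mem fun n _ => by simpa using S.smul_mem _ (hpow n)

variable {𝒜 : Type*} [NormedRing 𝒜] [NormedAlgebra ℝ 𝒜] [CompleteSpace 𝒜]

theorem continuous_exp : Continuous (exp : 𝒜 → 𝒜) :=
  letI := NormedAlgebra.restrictScalars ℚ ℝ 𝒜
  NormedSpace.exp_continuous

theorem exp_add_of_commute {a b : 𝒜} (h : Commute a b) : exp (a + b) = exp a * exp b :=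
  letI := NormedAlgebra.restrictScalars ℚ ℝ 𝒜
  NormedSpace.exp_add_of_commute h

theorem exp_add_smul (s t : ℝ) (a : 𝒜) : exp ((s + t) • a) = exp (s • a) * exp (t • a) := by
  rw [add_smul, exp_add_of_commute (((Commute.refl a).smul_left s).smul_right t)]

theorem exp_mul_exp_neg (a : 𝒜) : exp a * exp (-a) = 1 := by
  rw [← exp_add_of_commute (Commute.refl a).neg_right, add_neg_cancel, NormedSpace.exp_zero]

theorem exp_neg_mul_exp (a : 𝒜) : exp (-a) * exp a = 1 := by
  simpa using exp_mul_exp_neg (-a)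

theorem exp_conj_exp (a b : 𝒜) :
    exp (exp b * a * exp (-b)) = exp b * exp a * exp (-b) :=
  letI := NormedAlgebra.restrictScalars ℚ ℝ 𝒜
  NormedSpace.exp_units_conj ⟨exp b, exp (-b), exp_mul_exp_neg b, exp_neg_mul_exp b⟩ a

theorem exp_mulLeft_apply (a b : 𝒜) : exp (ContinuousLinearMap.mul ℝ 𝒜 b) a = exp b * a := by
  have hpow : ∀ n : ℕ, (ContinuousLinearMap.mul ℝ 𝒜 b ^ n) a = b ^ n * a := by
    intro n
    induction n with
    | zero => simp
    | succ n ih => rw [pow_succ', mul_apply_eq_comp, ih, pow_succ', mul_assoc]; rfl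
  refine ((NormedSpace.exp_series_hasSum_exp' (𝕂 := ℝ) _).mapL (.apply ℝ 𝒜 a)).unique ?_
  simpa [hpow] using (NormedSpace.exp_series_hasSum_exp' (𝕂 := ℝ) b).mul_right a

theorem exp_mulRight_apply (a b : 𝒜) :
    exp ((ContinuousLinearMap.mul ℝ 𝒜).flip b) a = a * exp b := by
  have hpow : ∀ n : ℕ, ((ContinuousLinearMap.mul ℝ 𝒜).flip b ^ n) a = a * b ^ n := by
    intro n
    induction n with
    | zero => simp
    | succ n ih => rw [pow_succ', mul_apply_eq_comp, ih, pow_succ, ← mul_assoc]; rfl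
  refine ((NormedSpace.exp_series_hasSum_exp' (𝕂 := ℝ) _).mapL (.apply ℝ 𝒜 a)).unique ?_
  simpa [hpow] using (NormedSpace.exp_series_hasSum_exp' (𝕂 := ℝ) b).mul_left a

theorem exp_mulLeft_sub_mulRight_apply (a b : 𝒜) :
    exp (ContinuousLinearMap.mul ℝ 𝒜 b - (ContinuousLinearMap.mul ℝ 𝒜).flip b) a =
      exp b * a * exp (-b) := by
  have hcomm : Commute (ContinuousLinearMap.mul ℝ 𝒜 b) ((ContinuousLinearMap.mul ℝ 𝒜).flip (-b)) :=
    ContinuousLinearMap.ext fun x => (mul_assoc b x (-b)).symm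
  rw [sub_eq_add_neg, ← map_neg, exp_add_of_commute hcomm, mul_apply_eq_comp, exp_mulLeft_apply,
    exp_mulRight_apply, mul_assoc]

theorem exp_mul_mul_exp_neg_mem {𝔩 : Submodule ℝ 𝒜} (h𝔩 : IsClosed (𝔩 : Set 𝒜)) {b : 𝒜}
    (hb : ∀ a ∈ 𝔩, ⁅b, a⁆ ∈ 𝔩) {a : 𝒜} (ha : a ∈ 𝔩) : exp b * a * exp (-b) ∈ 𝔩 := by
  rw [← exp_mulLeft_sub_mulRight_apply]
  exact exp_apply_mem h𝔩 hb ha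

theorem hasDerivAt_exp_smul_mul_mul (a b : 𝒜) :
    HasDerivAt (fun t : ℝ => exp (t • b) * a * exp (-(t • b))) ⁅b, a⁆ 0 := by
  simp only [← smul_neg]
  refine (((hasDerivAt_exp_smul_const b (0 : ℝ)).mul_const a).mul
    (hasDerivAt_exp_smul_const (-b) (0 : ℝ))).congr_deriv ?_
  simp [sub_eq_add_neg, Ring.lie_def]

/-- Conjugation by `exp (-εy)` moves `exp a * exp (εb₀)`, to first order in `ε`, in the direction
`exp a * (b₀ + (y - e⁻ᵃ y eᵃ))`. -/
theorem hasDerivAt_exp_mul_exp_sub_conj (a b₀ y : 𝒜) :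
    HasDerivAt (fun ε : ℝ => exp a * exp (ε • (b₀ + (y - exp (-a) * y * exp a))) -
      exp (ε • -y) * (exp a * exp (ε • b₀)) * exp (ε • y)) 0 0 := by
  have hleft := (hasDerivAt_exp_smul_const (b₀ + (y - exp (-a) * y * exp a)) (0 : ℝ)).const_mul
    (exp a)
  have hmid := (hasDerivAt_exp_smul_const b₀ (0 : ℝ)).const_mul (exp a)
  refine (hleft.sub (((hasDerivAt_exp_smul_const (-y) (0 : ℝ)).mul hmid).mul
    (hasDerivAt_exp_smul_const y (0 : ℝ)))).congr_deriv ?_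
  have hcancel : exp a * (exp (-a) * y * exp a) = y * exp a := by
    rw [mul_assoc, ← mul_assoc, exp_mul_exp_neg, one_mul]
  simp only [zero_smul, NormedSpace.exp_zero, one_mul, mul_one, Pi.mul_apply]
  rw [mul_add, mul_sub, hcancel]
  noncomm_ring

end BanachAlgebra

/-! ### Density of the exponentials of a Lie algebra of skew-adjoint elements -/

theorem exists_fixed_add_sub_of_isometry {V : Type*} [AddCommGroup V] [Module ℝ V]
    [FiniteDimensional ℝ V] {β : LinearMap.BilinForm ℝ V} (hβ : β.IsSymm)
    (hpos : ∀ x, x ≠ 0 → 0 < β x x) {T : V →ₗ[ℝ] V} (hT : ∀ x y, β (T x) (T y) = β x y) (x : V) :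
    ∃ x₀ y, T x₀ = x₀ ∧ x = x₀ + (y - T y) ∧ β x₀ x₀ ≤ β x x := by
  have hdef : ∀ z, β z z = 0 → z = 0 := fun z hz => by_contra fun h => (hpos z h).ne' hz
  have hcompl : IsCompl (LinearMap.id - T).range (β.orthogonal (LinearMap.id - T).range) := by
    refine LinearMap.BilinForm.isCompl_orthogonal_of_restrict_nondegenerate hβ.isRefl ?_
    have hsymm : (β.restrict (LinearMap.id - T).range).IsSymm := ⟨fun x y => hβ.eq x y⟩
    refine (LinearMap.IsRefl.nondegenerate_iff_separatingLeft hsymm.isRefl).2 fun z hz => ?_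
    exact Subtype.ext (hdef _ (hz z))
  obtain ⟨_, ⟨y, rfl⟩, x₀, hx₀, rfl⟩ := Submodule.mem_sup.1
    (hcompl.sup_eq_top ▸ Submodule.mem_top : x ∈ (LinearMap.id - T).range ⊔ _)
  have horth : ∀ z, β (z - T z) x₀ = 0 := fun z => hx₀ _ ⟨z, rfl⟩
  refine ⟨x₀, y, ?_, add_comm _ _, ?_⟩
  · have hfix : β (x₀ - T x₀) (x₀ - T x₀) = 2 * β (x₀ - T x₀) x₀ := by
      simp only [map_sub, LinearMap.sub_apply, hT, hβ.eq x₀ (T x₀)]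
      ring
    exact (sub_eq_zero.1 (hdef _ (by rw [hfix, horth, mul_zero]))).symm
  · have hnonneg : 0 ≤ β (y - T y) (y - T y) := by
      rcases eq_or_ne (y - T y) 0 with h | h
      · simp [h]
      · exact (hpos _ h).le
    have hcross : β x₀ (y - T y) = 0 := (hβ.eq _ _).trans (horth y)
    simp only [LinearMap.sub_apply, LinearMap.id_apply, map_add, LinearMap.add_apply, horth, hcross]
    linarith

theorem exists_mem_of_forall_eventually_step {E : Type*} [SeminormedAddCommGroup E] [ProperSpace E]
    {K : Set (ℝ × E)} {R : ℝ} (hK : IsClosed K) (hbound : ∀ p ∈ K, p.1 ≤ 1 → ‖p.2‖ ≤ R)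
    (hzero : ∃ x, (0, x) ∈ K)
    (hstep : ∀ t x, 0 ≤ t → (t, x) ∈ K → ∀ᶠ ε : ℝ in 𝓝[>] 0, ∃ y, (t + ε, y) ∈ K) :
    ∃ x, (1, x) ∈ K := by
  let S : Set ℝ := {t | ∃ x, (t, x) ∈ K}
  have hS : S ∩ Set.Icc 0 1 = Prod.fst '' (K ∩ Set.Icc 0 1 ×ˢ Metric.closedBall (0 : E) R) := by
    ext t
    constructor
    · rintro ⟨⟨x, hx⟩, ht⟩
      exact ⟨(t, x), ⟨hx, ht, mem_closedBall_zero_iff.2 (hbound _ hx ht.2)⟩, rfl⟩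
    · rintro ⟨⟨t, x⟩, ⟨hx, ht, -⟩, rfl⟩
      exact ⟨⟨x, hx⟩, ht⟩
  have hclosed : IsClosed (S ∩ Set.Icc 0 1) := by
    rw [hS]
    exact (((isCompact_Icc.prod (isCompact_closedBall _ _)).inter_left hK).image
      continuous_fst).isClosed
  refine hclosed.Icc_subset_of_forall_exists_gt hzero ?_ (Set.right_mem_Icc.2 zero_le_one)
  rintro t ⟨⟨x, hx⟩, ht⟩ s hs
  have hlt : ∀ᶠ ε : ℝ in 𝓝[>] 0, ε < s - t := nhdsWithin_le_nhds (gt_mem_nhds (sub_pos.2 hs))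
  obtain ⟨ε, hy, hεs, hε⟩ := ((hstep t x ht.1 hx).and (hlt.and self_mem_nhdsWithin)).exists
  exact ⟨t + ε, hy, lt_add_of_pos_right t hε, by linarith⟩

section CStar

variable {𝒜 : Type*} [NormedRing 𝒜] [NormedAlgebra ℝ 𝒜] [StarRing 𝒜]

/-- The Lie algebra of the skew-adjoint elements of a real star algebra. -/
def skewAdjointLie (𝒜 : Type*) [Ring 𝒜] [StarRing 𝒜] [Algebra ℝ 𝒜] [StarModule ℝ 𝒜] :
    LieSubalgebra ℝ 𝒜 where
  __ := skewAdjoint.submodule ℝ 𝒜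
  lie_mem' {a b} ha hb := by
    have ha : star a = -a := ha
    have hb : star b = -b := hb
    change star ⁅a, b⁆ = -⁅a, b⁆
    simp [Ring.lie_def, ha, hb]

/-- A real-linear functional that is tracial and whose quadratic form dominates the square of the
norm; on a skew-adjoint Lie algebra, `-τ (a * b)` is then an inner product invariant under the
adjoint action. -/
structure IsDominatingTrace (τ : 𝒜 →ₗ[ℝ] ℝ) : Prop where
  comm : ∀ a b, τ (a * b) = τ (b * a)
  sq_norm_le : ∀ a, ‖a‖ ^ 2 ≤ τ (star a * a)

namespace IsDominatingTrace

variable {τ : 𝒜 →ₗ[ℝ] ℝ} (hτ : IsDominatingTrace τ)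

include hτ

theorem sq_norm_le_neg_mul_self {a : 𝒜} (ha : star a = -a) : ‖a‖ ^ 2 ≤ -τ (a * a) := by
  simpa [ha] using hτ.sq_norm_le a

theorem map_lie_lie_mul (a b : 𝒜) : τ (⁅⁅a, b⁆, a⁆ * b) = τ (⁅a, b⁆ * ⁅a, b⁆) := by
  have hcyc : τ (a * (⁅a, b⁆ * b)) = τ (⁅a, b⁆ * b * a) := hτ.comm _ _
  calc τ (⁅⁅a, b⁆, a⁆ * b) = τ (⁅a, b⁆ * (a * b)) - τ (a * (⁅a, b⁆ * b)) := by
        rw [← map_sub, Ring.lie_def ⁅a, b⁆ a]; congr 1; noncomm_ring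
    _ = τ (⁅a, b⁆ * ⁅a, b⁆) := by
        rw [hcyc, ← map_sub, mul_assoc, ← mul_sub, ← Ring.lie_def]

variable [FiniteDimensional ℝ 𝒜]

theorem commute_of_isLocalMin [CompleteSpace 𝒜] {a b : 𝒜} (hskew : star ⁅a, b⁆ = -⁅a, b⁆)
    (hmin : IsLocalMin (fun t : ℝ => τ (exp (t • ⁅a, b⁆) * a * exp (-(t • ⁅a, b⁆)) * b)) 0) :
    Commute a b := by
  have hder : HasDerivAt (fun t : ℝ => τ (exp (t • ⁅a, b⁆) * a * exp (-(t • ⁅a, b⁆)) * b))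
      (τ (⁅⁅a, b⁆, a⁆ * b)) 0 :=
    (LinearMap.toContinuousLinearMap τ).hasFDerivAt.comp_hasDerivAt 0
      ((hasDerivAt_exp_smul_mul_mul a ⁅a, b⁆).mul_const b)
  have hzero : τ (⁅a, b⁆ * ⁅a, b⁆) = 0 :=
    (hτ.map_lie_lie_mul a b).symm.trans (hmin.hasDerivAt_eq_zero hder)
  have hnorm := hτ.sq_norm_le_neg_mul_self hskew
  rw [hzero, neg_zero] at hnorm
  exact sub_eq_zero.1 (norm_eq_zero.1 (sq_eq_zero_iff.1 (le_antisymm hnorm (sq_nonneg _))))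

end IsDominatingTrace

section Unitary

variable [CompleteSpace 𝒜] [CStarRing 𝒜]

theorem exp_mem_unitary {a : 𝒜} (ha : star a = -a) : exp a ∈ unitary 𝒜 :=
  letI := NormedAlgebra.restrictScalars ℚ ℝ 𝒜
  NormedSpace.exp_mem_unitary_of_mem_skewAdjoint ha

theorem norm_exp_mul_mul_exp_neg {b : 𝒜} (hb : star b = -b) (a : 𝒜) :
    ‖exp b * a * exp (-b)‖ = ‖a‖ :=
  (CStarRing.norm_mul_coe_unitary _ ⟨_, exp_mem_unitary (a := -b) (by simp [hb])⟩).trans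
    (CStarRing.norm_coe_unitary_mul ⟨_, exp_mem_unitary hb⟩ a)

end Unitary

variable [CompleteSpace 𝒜] [StarModule ℝ 𝒜] [FiniteDimensional ℝ 𝒜] {τ : 𝒜 →ₗ[ℝ] ℝ}
  {𝔩 : LieSubalgebra ℝ 𝒜} {a b : 𝒜}

theorem exp_mul_mul_exp_neg_mem_lieSubalgebra {𝒜 : Type*} [NormedRing 𝒜] [NormedAlgebra ℝ 𝒜]
    [CompleteSpace 𝒜] [FiniteDimensional ℝ 𝒜] {𝔩 : LieSubalgebra ℝ 𝒜} {a b : 𝒜}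
    (ha : a ∈ 𝔩) (hb : b ∈ 𝔩) : exp b * a * exp (-b) ∈ 𝔩 :=
  exp_mul_mul_exp_neg_mem (𝔩 := 𝔩.toSubmodule) 𝔩.toSubmodule.closed_of_finiteDimensional
    (fun _ hx => 𝔩.lie_mem hb hx) ha

theorem exists_commute_exp_add_sub_conj (h𝔩 : 𝔩 ≤ skewAdjointLie 𝒜) (hτ : IsDominatingTrace τ)
    (ha : a ∈ 𝔩) (hb : b ∈ 𝔩) :
    ∃ b₀ ∈ 𝔩, ∃ y ∈ 𝔩, Commute (exp a) b₀ ∧ ‖b₀‖ ≤ √(-τ (b * b)) ∧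
      b = b₀ + (y - exp (-a) * y * exp a) := by
  have hconj : ∀ y ∈ 𝔩, exp (-a) * y * exp a ∈ 𝔩 := fun y hy => by
    simpa using exp_mul_mul_exp_neg_mem_lieSubalgebra hy (𝔩.neg_mem ha)
  let β : LinearMap.BilinForm ℝ 𝔩 :=
    LinearMap.mk₂ ℝ (fun x y => -τ ((x : 𝒜) * y)) (by intros; simp [add_mul]; ring)
      (by intros; simp) (by intros; simp [mul_add]; ring) (by intros; simp)
  let Ad : 𝔩 →ₗ[ℝ] 𝔩 :=
    { toFun y := ⟨exp (-a) * y * exp a, hconj y y.2⟩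
      map_add' x y := Subtype.ext (by simp [mul_add, add_mul])
      map_smul' c x := Subtype.ext (by simp) }
  have hβpos : ∀ x, x ≠ 0 → 0 < β x x := fun x hx =>
    (pow_pos (norm_pos_iff.2 (by simpa using hx)) 2).trans_le
      (hτ.sq_norm_le_neg_mul_self (h𝔩 x.2))
  have hAd : ∀ x y, β (Ad x) (Ad y) = β x y := fun x y => by
    change -τ (exp (-a) * x * exp a * (exp (-a) * y * exp a)) = -τ (x * y)
    congr 1
    calc τ (exp (-a) * x * exp a * (exp (-a) * y * exp a))
        = τ (exp (-a) * (x * (exp a * exp (-a)) * y * exp a)) := by congr 1; noncomm_ring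
      _ = τ (x * y) := by
        rw [hτ.comm, exp_mul_exp_neg, mul_one, mul_assoc, exp_mul_exp_neg, mul_one]
  obtain ⟨b₀, y, hfix, hsplit, hle⟩ := exists_fixed_add_sub_of_isometry (β := β)
    ⟨fun x y => by simp [β, hτ.comm (x : 𝒜) y]⟩ hβpos hAd ⟨b, hb⟩
  refine ⟨b₀, b₀.2, y, y.2, ?_, ?_, congrArg Subtype.val hsplit⟩
  · have hb₀ : exp (-a) * b₀ * exp a = b₀ := congrArg Subtype.val hfix
    change exp a * (b₀ : 𝒜) = b₀ * exp a
    conv_lhs => rw [← hb₀, ← mul_assoc, ← mul_assoc, exp_mul_exp_neg, one_mul]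
  · exact Real.le_sqrt_of_sq_le ((hτ.sq_norm_le_neg_mul_self (h𝔩 b₀.2)).trans hle)

variable [CStarRing 𝒜]

/-- Among the logarithms of `exp a` in `𝔩` of norm at most `‖a‖`, one that minimizes `τ (· * b)` is
a critical point on its orbit under the centralizer of `exp a`, and so commutes with `b`. -/
theorem exists_exp_eq_commute (h𝔩 : 𝔩 ≤ skewAdjointLie 𝒜) (hτ : IsDominatingTrace τ)
    (ha : a ∈ 𝔩) (hb : b ∈ 𝔩) (hab : Commute (exp a) b) :
    ∃ a' ∈ 𝔩, exp a' = exp a ∧ ‖a'‖ ≤ ‖a‖ ∧ Commute a' b := by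
  have hτc : Continuous τ := τ.continuous_of_finiteDimensional
  have : ProperSpace 𝒜 := FiniteDimensional.proper ℝ 𝒜
  let S : Set 𝒜 := {x | x ∈ 𝔩 ∧ exp x = exp a} ∩ Metric.closedBall 0 ‖a‖
  have hS : IsCompact S := (isCompact_closedBall (0 : 𝒜) ‖a‖).inter_left
    (𝔩.toSubmodule.closed_of_finiteDimensional.inter (isClosed_eq continuous_exp continuous_const))
  obtain ⟨x, ⟨⟨hx, hexp⟩, hnorm⟩, hmin⟩ := hS.exists_isMinOn
    ⟨a, ⟨ha, rfl⟩, by simp⟩ (f := fun x => τ (x * b)) (by fun_prop)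
  rw [mem_closedBall_zero_iff] at hnorm
  have hmem : ⁅x, b⁆ ∈ 𝔩 := 𝔩.lie_mem hx hb
  have hcomm : Commute ⁅x, b⁆ (exp a) := by
    have hxa : Commute x (exp a) := hexp ▸ (Commute.refl x).exp_right
    exact (hxa.mul_left hab.symm).sub_left (hab.symm.mul_left hxa)
  have horbit : ∀ t : ℝ, exp (t • ⁅x, b⁆) * x * exp (-(t • ⁅x, b⁆)) ∈ S := by
    refine fun t => ⟨⟨exp_mul_mul_exp_neg_mem_lieSubalgebra hx (𝔩.smul_mem t hmem), ?_⟩, ?_⟩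
    · rw [exp_conj_exp, hexp, (hcomm.smul_left t).exp_left.eq, mul_assoc, exp_mul_exp_neg, mul_one]
    · rwa [mem_closedBall_zero_iff, norm_exp_mul_mul_exp_neg (h𝔩 (𝔩.smul_mem t hmem))]
  refine ⟨x, hx, hexp, hnorm, hτ.commute_of_isLocalMin (h𝔩 hmem) (.of_forall fun t => ?_)⟩
  simpa using hmin (horbit t)

theorem eventually_exists_exp_near (h𝔩 : 𝔩 ≤ skewAdjointLie 𝒜) (hτ : IsDominatingTrace τ)
    (ha : a ∈ 𝔩) (hb : b ∈ 𝔩) {δ : ℝ} (hδ : 0 < δ) :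
    ∀ᶠ ε : ℝ in 𝓝[>] 0, ∃ a' ∈ 𝔩, ‖a'‖ ≤ ‖a‖ + ε * √(-τ (b * b)) ∧
      ‖exp a * exp (ε • b) - exp a'‖ ≤ δ * ε := by
  obtain ⟨b₀, hb₀, y, hy, hcomm, hnorm, rfl⟩ := exists_commute_exp_add_sub_conj h𝔩 hτ ha hb
  obtain ⟨a₁, ha₁, hexp, hnorm₁, hcomm₁⟩ := exists_exp_eq_commute h𝔩 hτ ha hb₀ hcomm
  have hderiv := (hasDerivAt_iff_isLittleO.1 (hasDerivAt_exp_mul_exp_sub_conj a b₀ y)).def hδ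
  filter_upwards [nhdsWithin_le_nhds hderiv, self_mem_nhdsWithin] with ε hε (hpos : 0 < ε)
  have hεy : ε • -y ∈ 𝔩 := 𝔩.smul_mem _ (𝔩.neg_mem hy)
  refine ⟨_, exp_mul_mul_exp_neg_mem_lieSubalgebra (𝔩.add_mem ha₁ (𝔩.smul_mem ε hb₀)) hεy, ?_, ?_⟩
  · rw [norm_exp_mul_mul_exp_neg (h𝔩 hεy)]
    refine (norm_add_le _ _).trans (add_le_add hnorm₁ ?_)
    rw [norm_smul, Real.norm_of_nonneg hpos.le]
    gcongr
  · rw [exp_conj_exp, exp_add_of_commute (hcomm₁.smul_right ε), hexp]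
    simpa [abs_of_pos hpos] using hε

/-- One follows `exp a * exp (tb)` from `t = 0` to `t = 1` by exponentials of elements of `𝔩` that
stay in a fixed ball, with an error that grows at most like `δt`. -/
theorem exp_mul_exp_mem_closure (h𝔩 : 𝔩 ≤ skewAdjointLie 𝒜) (hτ : IsDominatingTrace τ)
    (ha : a ∈ 𝔩) (hb : b ∈ 𝔩) : exp a * exp b ∈ closure (exp '' (𝔩 : Set 𝒜)) := by
  have : ProperSpace 𝒜 := FiniteDimensional.proper ℝ 𝒜
  set M := √(-τ (b * b))
  refine Metric.mem_closure_iff.2 fun η hη => ?_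
  obtain ⟨δ, hδ, hδη⟩ := exists_between hη
  let K : Set (ℝ × 𝒜) := {p | p.2 ∈ 𝔩 ∧ ‖p.2‖ ≤ ‖a‖ + p.1 * M ∧
    ‖exp a * exp (p.1 • b) - exp p.2‖ ≤ δ * p.1}
  have hK : IsClosed K := by
    have hexp : Continuous fun p : ℝ × 𝒜 => exp p.2 := continuous_exp.comp continuous_snd
    have hexp' : Continuous fun p : ℝ × 𝒜 => exp (p.1 • b) := continuous_exp.comp (by fun_prop)
    refine (𝔩.toSubmodule.closed_of_finiteDimensional.preimage continuous_snd).and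
      ((isClosed_le ?_ ?_).and (isClosed_le ?_ ?_)) <;> fun_prop
  have hstep : ∀ t x, 0 ≤ t → (t, x) ∈ K → ∀ᶠ ε : ℝ in 𝓝[>] 0, ∃ y, (t + ε, y) ∈ K := by
    rintro t x - ⟨hx, hxM, hxδ⟩
    filter_upwards [eventually_exists_exp_near h𝔩 hτ hx hb hδ] with ε ⟨y, hy, hyM, hyδ⟩
    refine ⟨y, hy, by simp only at hxM ⊢; linarith, ?_⟩
    have hunit := CStarRing.norm_mul_coe_unitary (exp a * exp (t • b) - exp x)
      ⟨_, exp_mem_unitary (h𝔩 (𝔩.smul_mem ε hb))⟩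
    calc ‖exp a * exp ((t + ε) • b) - exp y‖
        = ‖(exp a * exp (t • b) - exp x) * exp (ε • b) + (exp x * exp (ε • b) - exp y)‖ := by
          rw [exp_add_smul]; congr 1; noncomm_ring
      _ ≤ δ * t + δ * ε := (norm_add_le _ _).trans (add_le_add (hunit.trans_le hxδ) hyδ)
      _ = δ * (t + ε) := by ring
  obtain ⟨x, hx, -, hxδ⟩ := exists_mem_of_forall_eventually_step hK (R := ‖a‖ + M)
    (fun p hp hp1 => hp.2.1.trans (by gcongr; exact mul_le_of_le_one_left (Real.sqrt_nonneg _) hp1))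
    ⟨a, ha, by simp, by simp⟩ hstep
  refine ⟨_, ⟨x, hx, rfl⟩, ?_⟩
  rw [dist_eq_norm]
  simp only [one_smul, mul_one] at hxδ
  exact hxδ.trans_lt hδη

end CStar

section ProductFormula

variable {𝒜 : Type*} [NormedRing 𝒜] [NormedAlgebra ℝ 𝒜] [CompleteSpace 𝒜]

theorem norm_unitary_pow_sub_pow_le {𝒜 : Type*} [NormedRing 𝒜] [StarRing 𝒜] [CStarRing 𝒜]
    (u v : unitary 𝒜) (n : ℕ) : ‖(u : 𝒜) ^ n - (v : 𝒜) ^ n‖ ≤ n * ‖(u : 𝒜) - v‖ := by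
  induction n with
  | zero => simp
  | succ n ih =>
    have hright := CStarRing.norm_mul_coe_unitary ((u : 𝒜) ^ n - (v : 𝒜) ^ n) u
    have hleft := CStarRing.norm_coe_unitary_mul (v ^ n) ((u : 𝒜) - v)
    calc ‖(u : 𝒜) ^ (n + 1) - (v : 𝒜) ^ (n + 1)‖
        = ‖((u : 𝒜) ^ n - (v : 𝒜) ^ n) * u + (v : 𝒜) ^ n * ((u : 𝒜) - v)‖ := by
          congr 1; rw [pow_succ, pow_succ]; noncomm_ring
      _ ≤ n * ‖(u : 𝒜) - v‖ + ‖(u : 𝒜) - v‖ := by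
          refine (norm_add_le _ _).trans (add_le_add (hright.trans_le ih) ?_)
          simpa using hleft.le
      _ = ((n + 1 : ℕ) : ℝ) * ‖(u : 𝒜) - v‖ := by push_cast; ring

theorem tendsto_inv_smul_exp_mul_exp_sub (a b : 𝒜) :
    Tendsto (fun s : ℝ => s⁻¹ • (exp (s • a) * exp (s • b) - exp (s • (a + b)))) (𝓝[≠] 0)
      (𝓝 0) := by
  have hderiv : HasDerivAt (fun s : ℝ => exp (s • a) * exp (s • b) - exp (s • (a + b))) 0 0 := by
    refine (((hasDerivAt_exp_smul_const a (0 : ℝ)).mul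
      (hasDerivAt_exp_smul_const b (0 : ℝ))).sub
      (hasDerivAt_exp_smul_const (a + b) (0 : ℝ))).congr_deriv ?_
    simp
  exact (hasDerivAt_iff_tendsto_slope.1 hderiv).congr fun s => by simp [slope]

theorem tendsto_exp_mul_exp_pow [StarRing 𝒜] [CStarRing 𝒜] [StarModule ℝ 𝒜] {a b : 𝒜}
    (ha : star a = -a) (hb : star b = -b) :
    Tendsto (fun n : ℕ => (exp ((n : ℝ)⁻¹ • a) * exp ((n : ℝ)⁻¹ • b)) ^ n) atTop
      (𝓝 (exp (a + b))) := by
  have hunit : ∀ {c : 𝒜} (s : ℝ), star c = -c → exp (s • c) ∈ unitary 𝒜 := fun s hc =>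
    exp_mem_unitary (by rw [star_smul, hc, star_trivial, smul_neg])
  have hinv : Tendsto (fun n : ℕ => (n : ℝ)⁻¹) atTop (𝓝[≠] 0) :=
    tendsto_nhdsWithin_iff.2 ⟨tendsto_inv_atTop_nhds_zero_nat, by
      filter_upwards [eventually_gt_atTop 0] with n hn; simpa using hn.ne'⟩
  have hzero := ((tendsto_inv_smul_exp_mul_exp_sub a b).comp hinv).norm
  rw [norm_zero] at hzero
  rw [tendsto_iff_norm_sub_tendsto_zero]
  refine squeeze_zero' (.of_forall fun _ => norm_nonneg _) ?_ hzero
  filter_upwards [eventually_gt_atTop 0] with n hn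
  have hpow : exp (a + b) = exp ((n : ℝ)⁻¹ • (a + b)) ^ n := by
    let := NormedAlgebra.restrictScalars ℚ ℝ 𝒜
    rw [← NormedSpace.exp_nsmul, ← Nat.cast_smul_eq_nsmul ℝ, smul_smul,
      mul_inv_cancel₀ (by exact_mod_cast hn.ne'), one_smul]
  rw [hpow]
  refine (norm_unitary_pow_sub_pow_le
    (⟨_, hunit (n : ℝ)⁻¹ ha⟩ * ⟨_, hunit (n : ℝ)⁻¹ hb⟩)
    ⟨_, hunit (n : ℝ)⁻¹ (c := a + b) (by simp [ha, hb, add_comm])⟩ n).trans (le_of_eq ?_)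
  simp [norm_smul]

end ProductFormula

/-! ### Families of unitaries -/

theorem mem_closure_of_forall_finset {ι : Type*} {X Y : ι → Type*} [∀ i, TopologicalSpace (X i)]
    [∀ i, TopologicalSpace (Y i)] {f : ∀ i, X i → Y i} (hf : ∀ i, IsInducing (f i))
    {s : Set (∀ i, X i)} {x : ∀ i, X i}
    (h : ∀ F : Finset ι,
      (fun i : F => f i (x i)) ∈ closure ((fun y (i : F) => f i (y i)) '' s)) :
    x ∈ closure s := by
  refine mem_closure_iff.2 fun o ho hxo => ?_
  obtain ⟨F, u, hu, hsub⟩ := isOpen_pi_iff.1 ho _ hxo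
  choose v hv hvu using fun i : F => (hf i).isOpen_iff.1 (hu i i.2).1
  obtain ⟨_, hyv, y, hy, rfl⟩ := mem_closure_iff.1 (h F) (Set.univ.pi v)
    (isOpen_set_pi Set.finite_univ fun i _ => hv i) fun i _ => by
      change x i ∈ f i ⁻¹' v i
      rw [hvu i]
      exact (hu i i.2).2
  refine ⟨y, hsub fun i hi => ?_, hy⟩
  rw [← hvu ⟨i, hi⟩]
  exact hyv ⟨i, hi⟩ trivial

theorem IsDominatingTrace.sum {ι : Type*} [Fintype ι] {A : ι → Type*} [∀ i, NormedRing (A i)]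
    [∀ i, NormedAlgebra ℝ (A i)] [∀ i, StarRing (A i)] {τ : ∀ i, A i →ₗ[ℝ] ℝ}
    (hτ : ∀ i, IsDominatingTrace (τ i)) :
    IsDominatingTrace (∑ i, τ i ∘ₗ LinearMap.proj i : (∀ i, A i) →ₗ[ℝ] ℝ) where
  comm x y := by
    simp only [LinearMap.sum_apply, LinearMap.comp_apply, LinearMap.proj_apply, Pi.mul_apply,
      (hτ _).comm (x _)]
  sq_norm_le x := by
    have hle : ∀ i, ‖x i‖ ^ 2 ≤ τ i (star (x i) * x i) := fun i => (hτ i).sq_norm_le (x i)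
    have hnonneg : ∀ i, 0 ≤ τ i (star (x i) * x i) := fun i => (sq_nonneg _).trans (hle i)
    simp only [LinearMap.sum_apply, LinearMap.comp_apply, LinearMap.proj_apply, Pi.mul_apply,
      Pi.star_apply]
    refine (Real.le_sqrt (norm_nonneg x) (Finset.sum_nonneg fun i _ => hnonneg i)).1 ?_
    refine (pi_norm_le_iff_of_nonneg (Real.sqrt_nonneg _)).2 fun i => Real.le_sqrt_of_sq_le ?_
    exact (hle i).trans (Finset.single_le_sum (fun i _ => hnonneg i) (Finset.mem_univ i))

section Family

variable {ι : Type*} {A : ι → Type*} [∀ i, NormedRing (A i)] [∀ i, NormedAlgebra ℝ (A i)]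
  [∀ i, StarRing (A i)] [∀ i, StarModule ℝ (A i)] [∀ i, CStarRing (A i)]
  [∀ i, CompleteSpace (A i)]

/-- The componentwise exponential of a family of skew-adjoint elements, as a family of
unitaries. -/
def expFamily (a : skewAdjointLie (∀ i, A i)) (i : ι) : unitary (A i) :=
  ⟨exp (a.1 i), exp_mem_unitary (congrFun a.2 i)⟩

theorem coe_expFamily (a : skewAdjointLie (∀ i, A i)) (i : ι) :
    (expFamily a i : A i) = exp (a.1 i) := rfl

theorem continuous_expFamily :
    Continuous (expFamily : skewAdjointLie (∀ i, A i) → ∀ i, unitary (A i)) :=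
  continuous_pi fun i =>
    (continuous_exp.comp ((continuous_apply i).comp continuous_subtype_val)).subtype_mk _

theorem expFamily_zero : expFamily (0 : skewAdjointLie (∀ i, A i)) = 1 :=
  funext fun i => Subtype.ext (by simp [coe_expFamily])

theorem expFamily_neg (a : skewAdjointLie (∀ i, A i)) : expFamily (-a) = (expFamily a)⁻¹ :=
  eq_inv_of_mul_eq_one_left <| funext fun i => Subtype.ext (exp_neg_mul_exp (a.1 i))

theorem expFamily_add_smul (s t : ℝ) (a : skewAdjointLie (∀ i, A i)) :
    expFamily ((s + t) • a) = expFamily (s • a) * expFamily (t • a) :=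
  funext fun i => Subtype.ext (exp_add_smul s t (a.1 i))

theorem continuous_expFamily_smul (a : skewAdjointLie (∀ i, A i)) :
    Continuous fun t : ℝ => expFamily (t • a) :=
  continuous_expFamily.comp (continuous_id.smul continuous_const)

theorem tendsto_expFamily_mul_pow (a b : skewAdjointLie (∀ i, A i)) :
    Tendsto (fun n : ℕ => (expFamily ((n : ℝ)⁻¹ • a) * expFamily ((n : ℝ)⁻¹ • b)) ^ n) atTop
      (𝓝 (expFamily (a + b))) :=
  tendsto_pi_nhds.2 fun i =>
    tendsto_subtype_rng.2 (tendsto_exp_mul_exp_pow (congrFun a.2 i) (congrFun b.2 i))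

/-- The adjoint action of `expFamily b` on a family `a`. -/
def conjExpFamily (b a : skewAdjointLie (∀ i, A i)) : skewAdjointLie (∀ i, A i) :=
  ⟨fun i => exp (b.1 i) * a.1 i * exp (-b.1 i), funext fun i => by
    have ha : star (a.1 i) = -a.1 i := congrFun a.2 i
    have hb : star (b.1 i) = -b.1 i := congrFun b.2 i
    change star (exp (b.1 i) * a.1 i * exp (-b.1 i)) = -(exp (b.1 i) * a.1 i * exp (-b.1 i))
    simp [NormedSpace.star_exp, ha, hb, mul_assoc]⟩

theorem expFamily_smul_conjExpFamily (t : ℝ) (b a : skewAdjointLie (∀ i, A i)) :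
    expFamily (t • conjExpFamily b a) = expFamily b * expFamily (t • a) * (expFamily b)⁻¹ := by
  rw [← expFamily_neg]
  refine funext fun i => Subtype.ext ?_
  have h := exp_conj_exp (t • a.1 i) (b.1 i)
  rw [mul_smul_comm, smul_mul_assoc] at h
  exact h

theorem tendsto_slope_conjExpFamily (b a : skewAdjointLie (∀ i, A i)) :
    Tendsto (fun s : ℝ => s⁻¹ • (conjExpFamily (s • b) a - a)) (𝓝[≠] 0) (𝓝 ⁅b, a⁆) := by
  refine tendsto_subtype_rng.2 (tendsto_pi_nhds.2 fun i => ?_)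
  refine (hasDerivAt_iff_tendsto_slope.1 (hasDerivAt_exp_smul_mul_mul (a.1 i) (b.1 i))).congr
    fun s => ?_
  simp [slope, conjExpFamily]

/-- The Lie algebra of a closed group of families of unitaries. -/
def lieAlgebraOf (G : Subgroup (∀ i, unitary (A i)))
    (hG : IsClosed (G : Set (∀ i, unitary (A i)))) :
    LieSubalgebra ℝ (skewAdjointLie (∀ i, A i)) :=
  let V : Submodule ℝ (skewAdjointLie (∀ i, A i)) :=
    { carrier := {a | ∀ t : ℝ, expFamily (t • a) ∈ G}
      zero_mem' := fun t => by rw [smul_zero, expFamily_zero]; exact G.one_mem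
      add_mem' := fun {a b} ha hb t => by
        rw [smul_add]
        refine hG.mem_of_tendsto (tendsto_expFamily_mul_pow (t • a) (t • b))
          (.of_forall fun n => ?_)
        rw [smul_smul, smul_smul]
        exact G.pow_mem (G.mul_mem (ha _) (hb _)) n
      smul_mem' := fun c a ha t => by rw [smul_smul]; exact ha _ }
  have hconj : ∀ {a b}, a ∈ V → b ∈ V → conjExpFamily a b ∈ V := fun {a b} ha hb t => by
    have hexp : expFamily a ∈ G := by simpa using ha 1
    rw [expFamily_smul_conjExpFamily]
    exact G.mul_mem (G.mul_mem hexp (hb t)) (G.inv_mem hexp)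
  { V with
    lie_mem' := fun {a b} ha hb t => by
      have hlim := (continuous_expFamily.tendsto _).comp
        ((tendsto_slope_conjExpFamily a b).const_smul t)
      exact hG.mem_of_tendsto hlim (.of_forall fun s =>
        V.smul_mem s⁻¹ (V.sub_mem (hconj (V.smul_mem s ha) hb) hb) t) }

theorem mem_lieAlgebraOf {G : Subgroup (∀ i, unitary (A i))}
    {hG : IsClosed (G : Set (∀ i, unitary (A i)))} {a : skewAdjointLie (∀ i, A i)} :
    a ∈ lieAlgebraOf G hG ↔ ∀ t : ℝ, expFamily (t • a) ∈ G := Iff.rfl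

theorem expFamily_mem_of_mem_lieSpan {G : Subgroup (∀ i, unitary (A i))}
    (hG : IsClosed (G : Set (∀ i, unitary (A i)))) {s : Set (skewAdjointLie (∀ i, A i))}
    (hs : ∀ a ∈ s, ∀ t : ℝ, expFamily (t • a) ∈ G) {a : skewAdjointLie (∀ i, A i)}
    (ha : a ∈ LieSubalgebra.lieSpan ℝ _ s) : expFamily a ∈ G := by
  have hle : LieSubalgebra.lieSpan ℝ _ s ≤ lieAlgebraOf G hG := LieSubalgebra.lieSpan_le.2 hs
  simpa using mem_lieAlgebraOf.1 (hle ha) 1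

variable [∀ i, FiniteDimensional ℝ (A i)] {τ : ∀ i, A i →ₗ[ℝ] ℝ}

theorem expFamily_mul_mem_closure (hτ : ∀ i, IsDominatingTrace (τ i))
    (𝔩 : LieSubalgebra ℝ (skewAdjointLie (∀ i, A i))) {a b : skewAdjointLie (∀ i, A i)}
    (ha : a ∈ 𝔩) (hb : b ∈ 𝔩) : expFamily a * expFamily b ∈ closure (expFamily '' 𝔩) := by
  refine mem_closure_of_forall_finset (fun i => IsInducing.subtypeVal) fun F => ?_
  let res : skewAdjointLie (∀ i, A i) →ₗ⁅ℝ⁆ (∀ i : F, A i) :=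
    { toFun a i := a.1 i
      map_add' _ _ := rfl
      map_smul' _ _ := rfl
      map_lie' := rfl }
  have hres : 𝔩.map res ≤ skewAdjointLie (∀ i : F, A i) := by
    rintro _ ⟨c, -, rfl⟩
    exact funext fun i : F => congrFun c.2 i
  have hexp : ∀ c, exp (res c) = fun i : F => (expFamily c i : A i) := fun c => by
    let := fun i => NormedAlgebra.restrictScalars ℚ ℝ (A i)
    exact funext (Pi.coe_exp (𝔸 := fun i : F => A i) (res c))
  have hmem := exp_mul_exp_mem_closure hres (IsDominatingTrace.sum fun i : F => hτ i)
    (Set.mem_image_of_mem res ha) (Set.mem_image_of_mem res hb)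
  have himage : exp '' (𝔩.map res : Set (∀ i : F, A i)) =
      (fun u (i : F) => (u i : A i)) '' (expFamily '' (𝔩 : Set (skewAdjointLie (∀ i, A i)))) := by
    change exp '' (res '' 𝔩) = _
    rw [Set.image_image, Set.image_image]
    exact Set.image_congr fun c _ => hexp c
  change exp (res a) * exp (res b) ∈ _ at hmem
  rwa [himage, hexp, hexp] at hmem

/-- The closure of the exponentials of a Lie algebra of families, which is a group. -/
def closureExp (hτ : ∀ i, IsDominatingTrace (τ i))
    (𝔩 : LieSubalgebra ℝ (skewAdjointLie (∀ i, A i))) : Subgroup (∀ i, unitary (A i)) where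
  carrier := closure (expFamily '' 𝔩)
  one_mem' := subset_closure ⟨0, 𝔩.zero_mem, expFamily_zero⟩
  mul_mem' {x y} hx hy := by
    have hright : ∀ b ∈ 𝔩, x * expFamily b ∈ closure (expFamily '' 𝔩) := fun b hb =>
      closure_minimal (by
        rintro _ ⟨a, ha, rfl⟩
        exact expFamily_mul_mem_closure hτ 𝔩 ha hb)
        (isClosed_closure.preimage (continuous_mul_const (expFamily b))) hx
    exact closure_minimal (by rintro _ ⟨b, hb, rfl⟩; exact hright b hb)
      (isClosed_closure.preimage (continuous_const_mul x)) hy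
  inv_mem' {x} hx := closure_minimal (by
    rintro _ ⟨a, ha, rfl⟩
    exact subset_closure ⟨-a, 𝔩.neg_mem ha, expFamily_neg a⟩)
    (isClosed_closure.preimage continuous_inv) hx

end Family

/-! ### The charge spaces -/

section ChargeSpace

variable {E : Type*} [NormedAddCommGroup E] [NormedSpace ℂ E]

theorem hasDerivAt_exp_smul (c : ℂ) (ψ : E) :
    HasDerivAt (fun t : ℝ => Complex.exp (c * t) • ψ) (c • ψ) 0 := by
  have hexp : HasDerivAt (fun t : ℝ => Complex.exp (c * t))
      (Complex.exp (c * (0 : ℝ)) * (c * 1)) 0 :=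
    ((Complex.ofRealCLM.hasDerivAt (x := (0 : ℝ))).const_mul c).cexp
  simpa using hexp.smul_const ψ

theorem integrable_fourier_smul {f : UnitAddCircle → E} (hf : Continuous f) (n : ℤ) :
    Integrable (fun x => fourier n x • f x) AddCircle.haarAddCircle :=
  ((map_continuous (fourier n)).smul hf).integrable_of_hasCompactSupport
    (HasCompactSupport.of_compactSpace _)

variable {𝓗 : Type*} [NormedAddCommGroup 𝓗] [InnerProductSpace ℂ 𝓗] [CompleteSpace 𝓗]

theorem hasDerivAt_unitary_apply {V : ℝ → unitary (𝓗 →L[ℂ] 𝓗)}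
    (hadd : ∀ s t, V (s + t) = V s * V t) {ψ φ : 𝓗}
    (hψ : HasDerivAt (fun t => (V t : 𝓗 →L[ℂ] 𝓗) ψ) φ 0) (s : ℝ) :
    HasDerivAt (fun t => (V t : 𝓗 →L[ℂ] 𝓗) ψ) ((V s : 𝓗 →L[ℂ] 𝓗) φ) s := by
  have hshift : (fun t => (V t : 𝓗 →L[ℂ] 𝓗) ψ) =
      fun t => (V s : 𝓗 →L[ℂ] 𝓗) ((V (t - s) : 𝓗 →L[ℂ] 𝓗) ψ) := funext fun t => by
    rw [← add_sub_cancel s t, hadd, add_sub_cancel]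
    rfl
  rw [hshift]
  exact ((V s : 𝓗 →L[ℂ] 𝓗).restrictScalars ℝ).hasFDerivAt.comp_hasDerivAt s
    (HasDerivAt.comp_sub_const s s (by rwa [sub_self]))

theorem apply_eq_exp_smul_of_hasDerivAt {V : ℝ → unitary (𝓗 →L[ℂ] 𝓗)}
    (hadd : ∀ s t, V (s + t) = V s * V t) {ψ : 𝓗} {c : ℂ}
    (hψ : HasDerivAt (fun t => (V t : 𝓗 →L[ℂ] 𝓗) ψ) (c • ψ) 0) (t : ℝ) :
    (V t : 𝓗 →L[ℂ] 𝓗) ψ = Complex.exp (c * t) • ψ := by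
  let g : ℝ → 𝓗 := fun t => Complex.exp (-(c * t)) • (V t : 𝓗 →L[ℂ] 𝓗) ψ
  have hg : ∀ s, HasDerivAt g 0 s := fun s => by
    have hexp : HasDerivAt (fun t : ℝ => Complex.exp (-(c * t)))
        (Complex.exp (-(c * s)) * (-(c * 1))) s :=
      ((Complex.ofRealCLM.hasDerivAt (x := s)).const_mul c).neg.cexp
    refine (hexp.smul (hasDerivAt_unitary_apply hadd hψ s)).congr_deriv ?_
    rw [map_smul, smul_smul, ← add_smul]
    ring_nf
    simp
  have h0 : V 0 = 1 := by simpa using hadd 0 0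
  have hconst : g t = g 0 := is_const_of_deriv_eq_zero (fun s => (hg s).differentiableAt)
    (fun s => (hg s).deriv) t 0
  simp only [g, h0, Complex.ofReal_zero, mul_zero, neg_zero, Complex.exp_zero, one_smul,
    OneMemClass.coe_one, one_apply_eq_self] at hconst
  nth_rw 2 [← hconst]
  rw [smul_smul, ← Complex.exp_add, add_neg_cancel, Complex.exp_zero, one_smul]

variable {π : Circle →* unitary (𝓗 →L[ℂ] 𝓗)} {μ : ℤ} {ψ : 𝓗}

theorem mem_chargeSpace_iff_hasDerivAt :
    ψ ∈ chargeSpace π μ ↔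
      HasDerivAt (fun α : ℝ => (π (Circle.exp α) : 𝓗 →L[ℂ] 𝓗) ψ) ((Complex.I * μ) • ψ) 0 := by
  have hsmul : ∀ φ : 𝓗, -Complex.I • φ = (μ : ℂ) • ψ ↔ φ = (Complex.I * μ) • ψ := fun φ => by
    rw [mul_smul, ← inv_smul_eq_iff₀ Complex.I_ne_zero, Complex.inv_I]
  constructor
  · rintro ⟨hdiff, heq⟩
    exact hasDerivAt_deriv_iff.2 hdiff |>.congr_deriv ((hsmul _).1 heq)
  · exact fun h => ⟨h.differentiableAt, (hsmul _).2 h.deriv⟩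

theorem mem_chargeSpace_iff :
    ψ ∈ chargeSpace π μ ↔ ∀ z : Circle, (π z : 𝓗 →L[ℂ] 𝓗) ψ = (z : ℂ) ^ μ • ψ := by
  have hexp : ∀ α : ℝ, (Circle.exp α : ℂ) ^ μ = Complex.exp (Complex.I * μ * α) := fun α => by
    rw [Circle.coe_exp, ← Complex.exp_int_mul]
    ring_nf
  rw [mem_chargeSpace_iff_hasDerivAt]
  constructor
  · intro h z
    obtain ⟨α, rfl⟩ := Circle.exp_surjective z
    rw [hexp]
    exact apply_eq_exp_smul_of_hasDerivAt (V := fun α => π (Circle.exp α))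
      (fun s t => by rw [Circle.exp_add, map_mul]) h α
  · intro h
    simp only [h, hexp]
    exact hasDerivAt_exp_smul _ ψ

variable (π) in
theorem chargeSpace_orthogonal : Pairwise (Function.onFun (· ⟂ ·) (chargeSpace π)) := by
  intro μ ν hμν
  rw [Function.onFun, Submodule.isOrtho_iff_inner_eq]
  intro φ hφ ψ hψ
  rw [mem_chargeSpace_iff] at hφ hψ
  set z : Circle := Circle.exp (Real.pi / (ν - μ : ℤ)) with hz
  have hpow : (starRingEnd ℂ) ((z : ℂ) ^ μ) * (z : ℂ) ^ ν = -1 := by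
    have hne : ((ν - μ : ℤ) : ℂ) ≠ 0 := by exact_mod_cast sub_ne_zero.2 hμν.symm
    rw [map_zpow₀, ← Circle.coe_inv_eq_conj, Circle.coe_inv, inv_zpow, ← zpow_neg,
      ← zpow_add₀ z.coe_ne_zero, neg_add_eq_sub, hz, Circle.coe_exp, ← Complex.exp_int_mul,
      ← Complex.exp_pi_mul_I, Complex.ofReal_div, Complex.ofReal_intCast]
    field_simp
  have hinner : ⟪φ, ψ⟫_ℂ = -⟪φ, ψ⟫_ℂ := by
    nth_rw 1 [← ContinuousLinearMap.inner_map_map_of_mem_unitary (π z).2 φ ψ]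
    rw [hφ, hψ, inner_smul_left, inner_smul_right, ← mul_assoc, hpow, neg_one_mul]
  exact self_eq_neg.1 hinner

theorem fourierCoeff_mem_chargeSpace (hψ : Continuous fun z => (π z : 𝓗 →L[ℂ] 𝓗) ψ) (n : ℤ) :
    fourierCoeff (fun x : UnitAddCircle => (π x.toCircle : 𝓗 →L[ℂ] 𝓗) ψ) n ∈
      chargeSpace π n := by
  refine mem_chargeSpace_iff.2 fun z => ?_
  obtain ⟨y, rfl⟩ := (AddCircle.homeomorphCircle one_ne_zero).surjective z
  rw [AddCircle.homeomorphCircle_apply]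
  let p : UnitAddCircle → 𝓗 := fun x => (π x.toCircle : 𝓗 →L[ℂ] 𝓗) ψ
  have hp : Continuous p := hψ.comp AddCircle.continuous_toCircle
  have htranslate : ∀ x, (π y.toCircle : 𝓗 →L[ℂ] 𝓗) (fourier (-n) x • p x) =
      fourier n y • (fourier (-n) (y + x) • p (y + x)) := fun x => by
    have hpx : (π y.toCircle : 𝓗 →L[ℂ] 𝓗) (p x) = p (y + x) := by
      simp only [p, AddCircle.toCircle_add, map_mul]
      rfl
    have hfourier : fourier n y * fourier (-n) (y + x) = fourier (-n) x := by
      rw [fourier_apply, fourier_apply, fourier_apply, ← Circle.coe_mul,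
        ← AddCircle.toCircle_add, smul_add, ← add_assoc, neg_smul, add_neg_cancel, zero_add]
    rw [map_smul, hpx, smul_smul, hfourier]
  calc (π y.toCircle : 𝓗 →L[ℂ] 𝓗) (fourierCoeff p n)
      = ∫ x, (π y.toCircle : 𝓗 →L[ℂ] 𝓗) (fourier (-n) x • p x) ∂AddCircle.haarAddCircle :=
        (ContinuousLinearMap.integral_comp_comm _ (integrable_fourier_smul hp (-n))).symm
    _ = fourier n y • fourierCoeff p n := by
        simp only [htranslate]
        rw [integral_smul, integral_add_left_eq_self (fun x => fourier (-n) x • p x) y,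
          fourierCoeff]
    _ = (y.toCircle : ℂ) ^ n • fourierCoeff p n := by
        rw [fourier_apply, AddCircle.toCircle_zsmul, Circle.coe_zpow]

theorem chargeSpace_total (hπ : ∀ ψ : 𝓗, Continuous fun z => (π z : 𝓗 →L[ℂ] 𝓗) ψ) :
    (⨆ μ, chargeSpace π μ)ᗮ = ⊥ := by
  refine (Submodule.eq_bot_iff _).2 fun φ hφ => ?_
  let p : UnitAddCircle → 𝓗 := fun x => (π x.toCircle : 𝓗 →L[ℂ] 𝓗) φ
  have hp : Continuous p := (hπ φ).comp AddCircle.continuous_toCircle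
  let f : C(UnitAddCircle, ℂ) := ⟨fun x => ⟪φ, p x⟫_ℂ, continuous_const.inner hp⟩
  have hcoeff : fourierCoeff f = 0 := funext fun n => by
    have hinner : fourierCoeff f n = ⟪φ, fourierCoeff p n⟫_ℂ := by
      have := ContinuousLinearMap.integral_comp_comm (innerSL ℂ φ) (integrable_fourier_smul hp (-n))
      simp only [innerSL_apply_apply, inner_smul_right] at this
      exact this
    rw [hinner]
    exact (Submodule.mem_orthogonal' _ _).1 hφ _
      (Submodule.mem_iSup_of_mem n (fourierCoeff_mem_chargeSpace (hπ φ) n))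
  have hsum := has_pointwise_sum_fourier_series_of_summable
    (f := f) (by rw [hcoeff]; exact summable_zero) 0
  simp only [hcoeff, Pi.zero_apply, zero_smul] at hsum
  have hf0 : f 0 = ⟪φ, φ⟫_ℂ := by simp [f, p]
  exact inner_self_eq_zero.1 (hf0 ▸ hsum.unique hasSum_zero)

theorem chargeSpace_isHilbertSum (hπ : ∀ ψ : 𝓗, Continuous fun z => (π z : 𝓗 →L[ℂ] 𝓗) ψ)
    [∀ μ : ℤ, FiniteDimensional ℂ (chargeSpace π μ)] :
    IsHilbertSum ℂ (fun μ => chargeSpace π μ) fun μ => (chargeSpace π μ).subtypeₗᵢ := by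
  refine IsHilbertSum.mkInternal _ (OrthogonalFamily.of_pairwise (chargeSpace_orthogonal π)) ?_
  rw [top_le_iff, Submodule.topologicalClosure_eq_top_iff]
  exact chargeSpace_total hπ

end ChargeSpace

/-! ### Block-diagonal unitaries -/

section Blocks

/-- The Hilbert sum of a family of isometric automorphisms of the summands. -/
def lpCongr {ι : Type*} {G : ι → Type*} [∀ i, NormedAddCommGroup (G i)]
    [∀ i, InnerProductSpace ℂ (G i)] (u : ∀ i, G i ≃ₗᵢ[ℂ] G i) : lp G 2 ≃ₗᵢ[ℂ] lp G 2 where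
  toFun f := ⟨fun i => u i (f i), by
    have h := lp.memℓp f
    rw [memℓp_gen_iff (by simp)] at h
    exact memℓp_gen (by simpa using h)⟩
  invFun f := ⟨fun i => (u i).symm (f i), by
    have h := lp.memℓp f
    rw [memℓp_gen_iff (by simp)] at h
    exact memℓp_gen (by simpa using h)⟩
  map_add' f g := lp.ext (funext fun i => map_add (u i) (f i) (g i))
  map_smul' c f := lp.ext (funext fun i => by simp)
  left_inv f := lp.ext (funext fun i => by simp)
  right_inv f := lp.ext (funext fun i => by simp)
  norm_map' f := by
    rw [lp.norm_eq_tsum_rpow (by simp), lp.norm_eq_tsum_rpow (by simp)]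
    simp

variable {𝓗 : Type*} [NormedAddCommGroup 𝓗] [InnerProductSpace ℂ 𝓗] [CompleteSpace 𝓗]
  {ι : Type*} {S : ι → Submodule ℂ 𝓗}

section CompleteBlocks

variable [∀ i, CompleteSpace (S i)]
  (hS : IsHilbertSum ℂ (fun i => S i) fun i => (S i).subtypeₗᵢ)

include hS in
theorem orthogonalProjectionOnto_of_mem_of_ne {i j : ι} (hij : i ≠ j) {ψ : 𝓗} (hψ : ψ ∈ S j) :
    (S i).orthogonalProjectionOnto ψ = 0 := by
  rw [Submodule.orthogonalProjectionOnto_eq_zero_iff, Submodule.mem_orthogonal]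
  exact fun φ hφ => hS.OrthogonalFamily hij ⟨φ, hφ⟩ ⟨ψ, hψ⟩

theorem linearIsometryEquiv_apply (ψ : 𝓗) (i : ι) :
    hS.linearIsometryEquiv ψ i = (S i).orthogonalProjectionOnto ψ := by
  have hsum := hS.hasSum_linearIsometryEquiv_symm (hS.linearIsometryEquiv ψ)
  rw [LinearIsometryEquiv.symm_apply_apply] at hsum
  rw [(hsum.mapL (S i).orthogonalProjectionOnto).unique (hasSum_single i fun j hj =>
    orthogonalProjectionOnto_of_mem_of_ne hS hj.symm (Submodule.coe_mem _))]
  simp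

include hS in
theorem hasSum_orthogonalProjectionOnto (ψ : 𝓗) :
    HasSum (fun i => ((S i).orthogonalProjectionOnto ψ : 𝓗)) ψ := by
  simpa [linearIsometryEquiv_apply] using
    hS.hasSum_linearIsometryEquiv_symm (hS.linearIsometryEquiv ψ)

include hS in
theorem ext_orthogonalProjectionOnto {φ ψ : 𝓗}
    (h : ∀ i, (S i).orthogonalProjectionOnto φ = (S i).orthogonalProjectionOnto ψ) : φ = ψ :=
  (hasSum_orthogonalProjectionOnto hS φ).unique <| by
    simpa only [h] using hasSum_orthogonalProjectionOnto hS ψ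

include hS in
theorem clm_ext_of_forall_mem {T T' : 𝓗 →L[ℂ] 𝓗} (h : ∀ i, ∀ ψ ∈ S i, T ψ = T' ψ) : T = T' := by
  ext ψ
  have hT := (hasSum_orthogonalProjectionOnto hS ψ).mapL T
  simp only [fun i => h i _ (Submodule.coe_mem ((S i).orthogonalProjectionOnto ψ))] at hT
  exact hT.unique ((hasSum_orthogonalProjectionOnto hS ψ).mapL T')

/-- The unitary operator with given unitary blocks. -/
def blockUnitary : (∀ i, unitary (S i →L[ℂ] S i)) →* unitary (𝓗 →L[ℂ] 𝓗) where
  toFun u := Unitary.linearIsometryEquiv.symm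
    ((hS.linearIsometryEquiv.trans
      (lpCongr fun i => Unitary.linearIsometryEquiv (u i))).trans hS.linearIsometryEquiv.symm)
  map_one' := by
    refine Subtype.ext (ContinuousLinearMap.ext fun ψ => hS.linearIsometryEquiv.injective ?_)
    refine Eq.trans (LinearIsometryEquiv.apply_symm_apply _ _) (lp.ext (funext fun i => rfl))
  map_mul' u v := by
    refine Subtype.ext (ContinuousLinearMap.ext fun ψ => hS.linearIsometryEquiv.injective ?_)
    refine (LinearIsometryEquiv.apply_symm_apply _ _).trans
      (Eq.symm ((LinearIsometryEquiv.apply_symm_apply _ _).trans (lp.ext (funext fun i => ?_))))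
    exact congrArg (fun f : lp (fun i => S i) 2 => (u i : S i →L[ℂ] S i) (f i))
      (LinearIsometryEquiv.apply_symm_apply hS.linearIsometryEquiv
        (lpCongr (fun i => Unitary.linearIsometryEquiv (v i)) (hS.linearIsometryEquiv ψ)))

theorem orthogonalProjectionOnto_blockUnitary (u : ∀ i, unitary (S i →L[ℂ] S i)) (ψ : 𝓗) (i : ι) :
    (S i).orthogonalProjectionOnto ((blockUnitary hS u : 𝓗 →L[ℂ] 𝓗) ψ) =
      (u i : S i →L[ℂ] S i) ((S i).orthogonalProjectionOnto ψ) := by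
  rw [← linearIsometryEquiv_apply hS, ← linearIsometryEquiv_apply hS]
  exact congrArg (fun f : lp (fun i => S i) 2 => f i)
    (LinearIsometryEquiv.apply_symm_apply hS.linearIsometryEquiv
      (lpCongr (fun i => Unitary.linearIsometryEquiv (u i)) (hS.linearIsometryEquiv ψ)))

theorem hasSum_blockUnitary (u : ∀ i, unitary (S i →L[ℂ] S i)) (ψ : 𝓗) :
    HasSum (fun i => ((u i : S i →L[ℂ] S i) ((S i).orthogonalProjectionOnto ψ) : 𝓗))
      ((blockUnitary hS u : 𝓗 →L[ℂ] 𝓗) ψ) := by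
  simp only [← orthogonalProjectionOnto_blockUnitary hS]
  exact hasSum_orthogonalProjectionOnto hS _

theorem blockUnitary_apply_of_mem (u : ∀ i, unitary (S i →L[ℂ] S i)) {i : ι} (ψ : S i) :
    (blockUnitary hS u : 𝓗 →L[ℂ] 𝓗) ψ = ((u i : S i →L[ℂ] S i) ψ : 𝓗) := by
  refine (hasSum_blockUnitary hS u ψ).unique ?_
  simpa using hasSum_single (f := fun j =>
    ((u j : S j →L[ℂ] S j) ((S j).orthogonalProjectionOnto (ψ : 𝓗)) : 𝓗)) i fun j hj => by
      rw [orthogonalProjectionOnto_of_mem_of_ne hS hj ψ.2, map_zero, ZeroMemClass.coe_zero]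

end CompleteBlocks

/-! ### The strong operator topology -/

theorem continuous_strongTopology_iff {X : Type*} [TopologicalSpace X]
    {f : X → unitary (𝓗 →L[ℂ] 𝓗)} :
    Continuous[_, strongTopology 𝓗] f ↔ ∀ ψ : 𝓗, Continuous fun x => (f x : 𝓗 →L[ℂ] 𝓗) ψ := by
  rw [continuous_induced_rng]
  exact ⟨fun h ψ => (PointwiseConvergenceCLM.evalCLM (RingHom.id ℂ) 𝓗 ψ).continuous.comp h,
    fun h => PointwiseConvergenceCLM.continuous_of_continuous_eval h⟩

theorem continuous_strongTopology_apply (ψ : 𝓗) :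
    Continuous[strongTopology 𝓗, _] fun U : unitary (𝓗 →L[ℂ] 𝓗) => (U : 𝓗 →L[ℂ] 𝓗) ψ :=
  letI := strongTopology 𝓗
  continuous_strongTopology_iff.1 continuous_id ψ

theorem continuous_blockUnitary [∀ i, CompleteSpace (S i)]
    (hS : IsHilbertSum ℂ (fun i => S i) fun i => (S i).subtypeₗᵢ) :
    Continuous[_, strongTopology 𝓗] (blockUnitary hS) := by
  rw [continuous_strongTopology_iff]
  intro ψ
  -- Unitaries are isometries, so truncating `ψ` approximates the orbit map uniformly in `u`.
  refine TendstoUniformly.continuous (p := atTop)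
    (F := fun (s : Finset ι) u => (blockUnitary hS u : 𝓗 →L[ℂ] 𝓗)
      (∑ i ∈ s, ((S i).orthogonalProjectionOnto ψ : 𝓗))) ?_ ?_
  · rw [Metric.tendstoUniformly_iff]
    intro ε hε
    filter_upwards [Metric.tendsto_nhds.1 (hasSum_orthogonalProjectionOnto hS ψ) ε hε] with s hs u
    rw [dist_eq_norm, ← map_sub,
      ContinuousLinearMap.norm_map_of_mem_unitary (blockUnitary hS u).2, ← dist_eq_norm, dist_comm]
    exact hs
  · refine Frequently.of_forall fun s => ?_
    simp only [map_sum, blockUnitary_apply_of_mem]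
    refine continuous_finsetSum _ fun i _ => ?_
    have hcoe : Continuous fun u : ∀ i, unitary (S i →L[ℂ] S i) => (u i : S i →L[ℂ] S i) :=
      continuous_subtype_val.comp (continuous_apply i)
    exact continuous_subtype_val.comp (hcoe.clm_apply continuous_const)

section FiniteDimensionalBlocks

variable [∀ i, FiniteDimensional ℂ (S i)]
  (hS : IsHilbertSum ℂ (fun i => S i) fun i => (S i).subtypeₗᵢ)

theorem mem_range_blockUnitary_iff {U : unitary (𝓗 →L[ℂ] 𝓗)} :
    U ∈ (blockUnitary hS).range ↔ ∀ i, ∀ ψ ∈ S i, (U : 𝓗 →L[ℂ] 𝓗) ψ ∈ S i := by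
  constructor
  · rintro ⟨u, rfl⟩ i ψ hψ
    rw [blockUnitary_apply_of_mem hS u ⟨ψ, hψ⟩]
    exact Submodule.coe_mem _
  · intro h
    let v : ∀ i, S i →ₗᵢ[ℂ] S i := fun i =>
      { toLinearMap := ((U : 𝓗 →L[ℂ] 𝓗) : 𝓗 →ₗ[ℂ] 𝓗).restrict (h i)
        norm_map' := fun ψ => ContinuousLinearMap.norm_map_of_mem_unitary U.2 (ψ : 𝓗) }
    refine ⟨fun i => Unitary.linearIsometryEquiv.symm ((v i).toLinearIsometryEquiv rfl),
      Subtype.ext (clm_ext_of_forall_mem hS fun i ψ hψ => ?_)⟩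
    rw [blockUnitary_apply_of_mem hS _ ⟨ψ, hψ⟩]
    rfl

theorem isClosed_range_blockUnitary :
    IsClosed[strongTopology 𝓗] ((blockUnitary hS).range : Set (unitary (𝓗 →L[ℂ] 𝓗))) := by
  let := strongTopology 𝓗
  have heq : ((blockUnitary hS).range : Set (unitary (𝓗 →L[ℂ] 𝓗))) =
      ⋂ (i) (ψ : 𝓗) (_ : ψ ∈ S i),
        (fun U : unitary (𝓗 →L[ℂ] 𝓗) => (U : 𝓗 →L[ℂ] 𝓗) ψ) ⁻¹' (S i) := by
    ext U
    simp only [SetLike.mem_coe, mem_range_blockUnitary_iff, Set.mem_iInter, Set.mem_preimage]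
  rw [heq]
  exact isClosed_iInter fun i => isClosed_iInter fun ψ => isClosed_iInter fun _ =>
    (S i).closed_of_finiteDimensional.preimage (continuous_strongTopology_apply ψ)

theorem isClosedEmbedding_blockUnitary :
    @IsClosedEmbedding _ _ _ (strongTopology 𝓗) (blockUnitary hS) := by
  let := strongTopology 𝓗
  refine ⟨?_, isClosed_range_blockUnitary hS⟩
  let compress : unitary (𝓗 →L[ℂ] 𝓗) → ∀ i, S i →L[ℂ] S i := fun U i =>
    (S i).orthogonalProjectionOnto ∘L (U : 𝓗 →L[ℂ] 𝓗) ∘L (S i).subtypeL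
  have hcompress : Continuous compress := continuous_pi fun i => continuous_clm_apply.2 fun ψ =>
    (S i).orthogonalProjectionOnto.continuous.comp (continuous_strongTopology_apply (ψ : 𝓗))
  refine .of_comp (continuous_blockUnitary hS) hcompress ?_
  have hcomp : compress ∘ blockUnitary hS = Pi.map fun i => Subtype.val := by
    funext u i
    ext ψ
    simp [compress, orthogonalProjectionOnto_blockUnitary]
  rw [hcomp]
  exact .piMap fun i => .subtypeVal

end FiniteDimensionalBlocks

end Blocks

/-! ### Operators on finite-dimensional spaces -/

section FiniteDimensional

variable {E : Type*} [NormedAddCommGroup E] [InnerProductSpace ℂ E] [FiniteDimensional ℂ E]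

variable (E) in
/-- The real part of the trace, the standard example of an `IsDominatingTrace`. -/
def reTrace : (E →L[ℂ] E) →ₗ[ℝ] ℝ where
  toFun a := (LinearMap.trace ℂ E (a : E →ₗ[ℂ] E)).re
  map_add' a b := by simp
  map_smul' c a := by
    have hc : ((c • a : E →L[ℂ] E) : E →ₗ[ℂ] E) = (c : ℂ) • (a : E →ₗ[ℂ] E) := by ext; simp
    simp [hc]

theorem reTrace_star_mul_self {ι : Type*} [Fintype ι] (b : OrthonormalBasis ι ℂ E)
    (a : E →L[ℂ] E) : reTrace E (star a * a) = ∑ i, ‖a (b i)‖ ^ 2 := by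
  change (LinearMap.trace ℂ E ((star a * a : E →L[ℂ] E) : E →ₗ[ℂ] E)).re = _
  rw [LinearMap.trace_eq_sum_inner _ b, Complex.re_sum]
  refine Finset.sum_congr rfl fun i _ => ?_
  have hinner : ⟪b i, (star a * a : E →L[ℂ] E) (b i)⟫_ℂ = ⟪a (b i), a (b i)⟫_ℂ :=
    ContinuousLinearMap.adjoint_inner_right a (b i) (a (b i))
  rw [← inner_self_eq_norm_sq (𝕜 := ℂ), ← hinner]
  rfl

omit [FiniteDimensional ℂ E] in
theorem sq_norm_le_sum_sq_norm_apply {F ι : Type*} [NormedAddCommGroup F] [NormedSpace ℂ F]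
    [Fintype ι] (b : OrthonormalBasis ι ℂ E) (a : E →L[ℂ] F) :
    ‖a‖ ^ 2 ≤ ∑ i, ‖a (b i)‖ ^ 2 := by
  have hle : ‖a‖ ≤ √(∑ i, ‖a (b i)‖ ^ 2) := by
    refine a.opNorm_le_bound (Real.sqrt_nonneg _) fun x => ?_
    calc ‖a x‖ = ‖∑ i, ⟪b i, x⟫_ℂ • a (b i)‖ := by
          conv_lhs => rw [← b.sum_repr' x]
          simp
      _ ≤ ∑ i, ‖⟪b i, x⟫_ℂ‖ * ‖a (b i)‖ := by
          simpa only [norm_smul] using norm_sum_le Finset.univ fun i => ⟪b i, x⟫_ℂ • a (b i)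
      _ ≤ √(∑ i, ‖⟪b i, x⟫_ℂ‖ ^ 2) * √(∑ i, ‖a (b i)‖ ^ 2) := Real.sum_mul_le_sqrt_mul_sqrt _ _ _
      _ = √(∑ i, ‖a (b i)‖ ^ 2) * ‖x‖ := by
          rw [b.sum_sq_norm_inner_right, Real.sqrt_sq (norm_nonneg x), mul_comm]
  calc ‖a‖ ^ 2 ≤ √(∑ i, ‖a (b i)‖ ^ 2) ^ 2 := by gcongr
    _ = ∑ i, ‖a (b i)‖ ^ 2 := Real.sq_sqrt (Finset.sum_nonneg fun i _ => sq_nonneg _)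

theorem isDominatingTrace_reTrace : IsDominatingTrace (reTrace E) where
  comm a b := congrArg Complex.re (LinearMap.trace_mul_comm ℂ (a : E →ₗ[ℂ] E) (b : E →ₗ[ℂ] E))
  sq_norm_le a := by
    rw [reTrace_star_mul_self (stdOrthonormalBasis ℂ E)]
    exact sq_norm_le_sum_sq_norm_apply _ a

omit [FiniteDimensional ℂ E] in
theorem exp_apply_of_apply_eq_smul [CompleteSpace E] {a : E →L[ℂ] E} {c : ℂ} {v : E}
    (h : a v = c • v) : exp a v = Complex.exp c • v := by
  have hexp := (NormedSpace.exp_series_hasSum_exp' (𝕂 := ℂ) a).mapL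
    (ContinuousLinearMap.apply ℂ E v)
  have hsmul := (NormedSpace.exp_series_hasSum_exp' (𝕂 := ℂ) c).smul_const v
  rw [← Complex.exp_eq_exp_ℂ] at hsmul
  refine hexp.unique ?_
  convert! hsmul using 2 with n
  have hpow : (a ^ n) v = c ^ n • v := by
    induction n with
    | zero => simp
    | succ n ih => rw [pow_succ', mul_apply_eq_comp, ih, map_smul, h, smul_smul, pow_succ]
  simp [hpow, smul_smul]

theorem exists_exp_eq_of_finite_spectrum {A : Type*} [CStarAlgebra A] {u : A} (hu : u ∈ unitary A)
    (hfin : (spectrum ℂ u).Finite) : ∃ a : A, star a = -a ∧ exp a = u := by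
  have hnormal : IsStarNormal u := isStarNormal_of_mem_unitary hu
  -- The argument is discontinuous on the circle, but not on a finite subset of it.
  let logarithm : ℂ → ℂ := fun z => (Complex.arg z : ℂ) * Complex.I
  refine ⟨cfc logarithm u, ?_, ?_⟩
  · rw [← cfc_star, ← cfc_neg]
    simp [logarithm]
  · rw [← CFC.exp_eq_normedSpace_exp (𝕜 := ℂ),
      ← cfc_comp' (fun z => exp z) logarithm u (by exact (hfin.image _).continuousOn _)
        (hfin.continuousOn _)]
    conv_rhs => rw [← cfc_id' ℂ u]
    refine cfc_congr fun z hz => ?_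
    have hz1 : ‖z‖ = 1 := by simpa using spectrum.subset_circle_of_unitary hu hz
    simpa [hz1, logarithm, ← Complex.exp_eq_exp_ℂ] using Complex.norm_mul_exp_arg_mul_I z

theorem finite_spectrum_clm {F : Type*} [NormedAddCommGroup F] [NormedSpace ℂ F]
    [FiniteDimensional ℂ F] (u : F →L[ℂ] F) : (spectrum ℂ u).Finite := by
  rw [show u = Module.End.toContinuousLinearMap (𝕜 := ℂ) F (u : F →ₗ[ℂ] F) from rfl,
    AlgEquiv.spectrum_eq]
  exact Module.End.finite_spectrum _

theorem exists_exp_eq_of_mem_unitary {u : E →L[ℂ] E} (hu : u ∈ unitary (E →L[ℂ] E)) :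
    ∃ a : E →L[ℂ] E, star a = -a ∧ exp a = u :=
  exists_exp_eq_of_finite_spectrum hu (finite_spectrum_clm u)

theorem exists_orthonormalBasis_apply_eq_smul {h : E →L[ℂ] E} (hh : IsSelfAdjoint h) :
    ∃ (b : OrthonormalBasis (Fin (Module.finrank ℂ E)) ℂ E) (l : Fin (Module.finrank ℂ E) → ℝ),
      ∀ i, h (b i) = (l i : ℂ) • b i :=
  have hs : (h : E →ₗ[ℂ] E).IsSymmetric := ContinuousLinearMap.isSelfAdjoint_iff_isSymmetric.1 hh
  ⟨hs.eigenvectorBasis rfl, hs.eigenvalues rfl, hs.apply_eigenvectorBasis rfl⟩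

end FiniteDimensional

/-! ### Diagonal operators -/

section Diagonal

variable {𝓗 : Type*} [NormedAddCommGroup 𝓗] [InnerProductSpace ℂ 𝓗] {ι : Type*}

theorem memℓp_two_iff {c : ι → ℂ} : Memℓp c 2 ↔ Summable fun i => ‖c i‖ ^ 2 := by
  rw [memℓp_gen_iff (by simp)]
  simp

theorem repr_ext (b : HilbertBasis ι ℂ 𝓗) {φ ψ : 𝓗} (h : ∀ i, b.repr φ i = b.repr ψ i) : φ = ψ :=
  b.repr.injective (lp.ext (funext h))

theorem clm_ext_hilbertBasis (b : HilbertBasis ι ℂ 𝓗) {S T : 𝓗 →L[ℂ] 𝓗}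
    (h : ∀ i, S (b i) = T (b i)) : S = T := by
  ext ψ
  refine ((b.hasSum_repr ψ).mapL S).unique ?_
  simpa only [map_smul, h] using (b.hasSum_repr ψ).mapL T

theorem hasSum_sq_norm_repr (b : HilbertBasis ι ℂ 𝓗) (ψ : 𝓗) :
    HasSum (fun i => ‖b.repr ψ i‖ ^ 2) (‖ψ‖ ^ 2) := by
  simpa using lp.hasSum_norm (p := 2) (by simp) (b.repr ψ)

/-- The operator that is diagonal in the Hilbert basis `b`, with real eigenvalues `l`, on its
maximal domain. -/
def diagOp (b : HilbertBasis ι ℂ 𝓗) (l : ι → ℝ) : 𝓗 →ₗ.[ℂ] 𝓗 where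
  domain :=
    { carrier := {ψ | Memℓp (fun i => (l i : ℂ) * b.repr ψ i) 2}
      add_mem' := fun {φ ψ} hφ hψ => by
        simp only [Set.mem_ofPred_eq, map_add, lp.coeFn_add, Pi.add_apply, mul_add]
        exact hφ.add hψ
      zero_mem' := by
        simp only [Set.mem_ofPred_eq, map_zero, lp.coeFn_zero, Pi.zero_apply, mul_zero]
        exact zero_memℓp
      smul_mem' := fun c ψ hψ => by
        simp only [Set.mem_ofPred_eq, map_smul, lp.coeFn_smul, Pi.smul_apply, smul_eq_mul,
          mul_left_comm _ c]
        exact hψ.const_smul c }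
  toFun :=
    { toFun := fun ψ => b.repr.symm ⟨fun i => (l i : ℂ) * b.repr ψ i, ψ.2⟩
      map_add' := fun φ ψ => repr_ext b fun i => by
        rw [map_add, lp.coeFn_add, Pi.add_apply]
        simp only [LinearIsometryEquiv.apply_symm_apply]
        rw [Submodule.coe_add, map_add, lp.coeFn_add, Pi.add_apply, mul_add]
      map_smul' := fun c ψ => repr_ext b fun i => by simp [mul_left_comm] }

variable (b : HilbertBasis ι ℂ 𝓗) (l : ι → ℝ)

theorem repr_diagOp (ψ : (diagOp b l).domain) (i : ι) :
    b.repr (diagOp b l ψ) i = l i * b.repr ψ i := by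
  change b.repr (b.repr.symm _) i = _
  rw [LinearIsometryEquiv.apply_symm_apply]

theorem mem_diagOp_graph_iff {φ ψ : 𝓗} :
    (ψ, φ) ∈ (diagOp b l).graph ↔ ∀ i, b.repr φ i = l i * b.repr ψ i := by
  rw [LinearPMap.mem_graph_iff]
  constructor
  · rintro ⟨x, rfl, rfl⟩ i
    exact repr_diagOp b l x i
  · intro h
    have hmem : Memℓp (fun i => (l i : ℂ) * b.repr ψ i) 2 := by
      simpa only [← h] using lp.memℓp (b.repr φ)
    refine ⟨⟨ψ, hmem⟩, rfl, repr_ext b fun i => ?_⟩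
    rw [h, repr_diagOp]

theorem hilbertBasis_mem_diagOp_graph (i : ι) :
    (b i, (l i : ℂ) • b i) ∈ (diagOp b l).graph := by
  classical
  rw [mem_diagOp_graph_iff]
  intro j
  rw [map_smul, lp.coeFn_smul, Pi.smul_apply, smul_eq_mul, b.repr_self]
  rcases eq_or_ne j i with rfl | h
  · rfl
  · rw [lp.single_apply_ne 2 i _ h, mul_zero, mul_zero]

theorem hilbertBasis_mem_diagOp_domain (i : ι) : b i ∈ (diagOp b l).domain :=
  LinearPMap.mem_domain_of_mem_graph (hilbertBasis_mem_diagOp_graph b l i)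

theorem dense_diagOp_domain : Dense ((diagOp b l).domain : Set 𝓗) := by
  have hspan : Submodule.span ℂ (Set.range b) ≤ (diagOp b l).domain :=
    Submodule.span_le.2 (Set.range_subset_iff.2 (hilbertBasis_mem_diagOp_domain b l))
  exact (Submodule.dense_iff_topologicalClosure_eq_top.2 b.dense_span).mono hspan

theorem mem_graph_adjoint_iff {g : Submodule ℂ (𝓗 × 𝓗)} {x : 𝓗 × 𝓗} :
    x ∈ g.adjoint ↔ ∀ y ∈ g, ⟪y.2, x.1⟫_ℂ = ⟪y.1, x.2⟫_ℂ := by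
  rw [Submodule.mem_adjoint_iff]
  exact ⟨fun h y hy => sub_eq_zero.1 (h y.1 y.2 hy), fun h a c hac => sub_eq_zero.2 (h _ hac)⟩

theorem mem_diagOp_graph_of_inner_eq {φ ψ : 𝓗} (h : ∀ i, ⟪(l i : ℂ) • b i, ψ⟫_ℂ = ⟪b i, φ⟫_ℂ) :
    (ψ, φ) ∈ (diagOp b l).graph := by
  rw [mem_diagOp_graph_iff]
  intro i
  rw [b.repr_apply_apply, b.repr_apply_apply, ← h, inner_smul_left, Complex.conj_ofReal]

theorem diagOp_le_of_isClosed {T : 𝓗 →ₗ.[ℂ] 𝓗} (hT : T.IsClosed)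
    (h : ∀ i, (b i, (l i : ℂ) • b i) ∈ T.graph) : diagOp b l ≤ T := by
  refine LinearPMap.le_of_le_graph ?_
  rintro ⟨ψ, φ⟩ hφ
  rw [mem_diagOp_graph_iff] at hφ
  refine hT.mem_of_tendsto ((b.hasSum_repr ψ).prodMk (b.hasSum_repr φ))
    (Eventually.of_forall fun s => T.graph.sum_mem fun i _ => ?_)
  rw [hφ i, mul_comm, mul_smul]
  exact T.graph.smul_mem (b.repr ψ i) (h i)

variable [CompleteSpace 𝓗]

theorem isSelfAdjoint_diagOp : IsSelfAdjoint (diagOp b l) := by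
  rw [LinearPMap.isSelfAdjoint_def]
  refine LinearPMap.eq_of_eq_graph ?_
  rw [LinearPMap.adjoint_graph_eq_graph_adjoint (dense_diagOp_domain b l)]
  ext ⟨ψ, φ⟩
  rw [mem_graph_adjoint_iff]
  constructor
  · intro h
    exact mem_diagOp_graph_of_inner_eq b l fun i => h _ (hilbertBasis_mem_diagOp_graph b l i)
  · rintro h ⟨x, y⟩ hy
    simp only [mem_diagOp_graph_iff, b.repr_apply_apply] at h hy
    refine (b.hasSum_inner_mul_inner y ψ).unique ?_
    convert! b.hasSum_inner_mul_inner x φ using 2 with i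
    rw [h i, ← inner_conj_symm y (b i), hy i, map_mul, Complex.conj_ofReal, inner_conj_symm]
    ring

theorem eq_diagOp {T : 𝓗 →ₗ.[ℂ] 𝓗} (hT : IsSelfAdjoint T)
    (h : ∀ i, (b i, (l i : ℂ) • b i) ∈ T.graph) : T = diagOp b l := by
  refine le_antisymm (LinearPMap.le_of_le_graph ?_) (diagOp_le_of_isClosed b l hT.isClosed h)
  rintro ⟨ψ, φ⟩ hφ
  rw [← LinearPMap.isSelfAdjoint_def.1 hT,
    LinearPMap.adjoint_graph_eq_graph_adjoint hT.dense_domain, mem_graph_adjoint_iff] at hφ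
  exact mem_diagOp_graph_of_inner_eq b l fun i => hφ _ (h i)

theorem diagOp_hasCore {S : Submodule ℂ 𝓗} (hS : S ≤ (diagOp b l).domain) (hb : ∀ i, b i ∈ S) :
    (diagOp b l).HasCore S := by
  have hclosed := (isSelfAdjoint_diagOp b l).isClosed
  have hclosable : ((diagOp b l).domRestrict S).IsClosable :=
    hclosed.isClosable.leIsClosable LinearPMap.domRestrict_le
  refine ⟨hS, le_antisymm ?_ ?_⟩
  · refine LinearPMap.le_of_le_graph ?_
    rw [← hclosable.graph_closure_eq_closure_graph]
    exact Submodule.topologicalClosure_minimal _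
      (LinearPMap.le_graph_of_le LinearPMap.domRestrict_le) hclosed
  · refine diagOp_le_of_isClosed b l hclosable.closure_isClosed fun i =>
      LinearPMap.le_graph_of_le (LinearPMap.le_closure _) ?_
    obtain ⟨x, hx, hx'⟩ := (LinearPMap.mem_graph_iff _).1 (hilbertBasis_mem_diagOp_graph b l i)
    rw [LinearPMap.mem_graph_iff]
    refine ⟨⟨b i, hb i, hilbertBasis_mem_diagOp_domain b l i⟩, rfl, ?_⟩
    rw [← hx']
    exact LinearPMap.domRestrict_apply hx.symm

/-! ### The unitary group of a diagonal operator -/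

theorem mem_generator_graph_iff {V : ℝ → unitary (𝓗 →L[ℂ] 𝓗)} {φ ψ : 𝓗} :
    (ψ, φ) ∈ (generator V).graph ↔ HasDerivAt (fun t => (V t : 𝓗 →L[ℂ] 𝓗) ψ) φ 0 := by
  rw [LinearPMap.mem_graph_iff]
  constructor
  · rintro ⟨⟨x, hx⟩, rfl, rfl⟩
    exact DifferentiableAt.hasDerivAt hx
  · intro h
    exact ⟨⟨ψ, h.differentiableAt⟩, rfl, h.deriv⟩

omit [CompleteSpace 𝓗] in
theorem mem_I_smul_graph_iff {T : 𝓗 →ₗ.[ℂ] 𝓗} {φ ψ : 𝓗} :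
    (ψ, φ) ∈ (Complex.I • T).graph ↔ (ψ, (-Complex.I) • φ) ∈ T.graph := by
  have hsmul : ∀ x : 𝓗, Complex.I • x = φ ↔ x = (-Complex.I) • φ := fun x => by
    rw [← Complex.inv_I, eq_inv_smul_iff₀ Complex.I_ne_zero]
  simp only [LinearPMap.mem_graph_iff, LinearPMap.smul_apply, hsmul]
  rfl

omit [CompleteSpace 𝓗] in
theorem mem_I_smul_diagOp_graph_iff {φ ψ : 𝓗} :
    (ψ, φ) ∈ (Complex.I • diagOp b l).graph ↔
      ∀ i, b.repr φ i = Complex.I * l i * b.repr ψ i := by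
  rw [mem_I_smul_graph_iff, mem_diagOp_graph_iff]
  refine forall_congr' fun i => ?_
  rw [map_smul, lp.coeFn_smul, Pi.smul_apply, ← Complex.inv_I,
    inv_smul_eq_iff₀ Complex.I_ne_zero, smul_eq_mul, mul_assoc]

variable {b l} {V W : ℝ → unitary (𝓗 →L[ℂ] 𝓗)}

theorem repr_diagGroup
    (hV : ∀ t i, (V t : 𝓗 →L[ℂ] 𝓗) (b i) = Complex.exp (Complex.I * l i * t) • b i)
    (t : ℝ) (i : ι) (ψ : 𝓗) :
    b.repr ((V t : 𝓗 →L[ℂ] 𝓗) ψ) i = Complex.exp (Complex.I * l i * t) * b.repr ψ i := by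
  have hinner := ContinuousLinearMap.inner_map_map_of_mem_unitary (V t).2 (b i) ψ
  rw [hV, inner_smul_left] at hinner
  rw [b.repr_apply_apply, b.repr_apply_apply, ← hinner, ← mul_assoc, ← Complex.exp_conj,
    ← Complex.exp_add]
  simp

theorem eq_add_integral_diagGroup (hVg : IsUnitaryGroup V)
    (hV : ∀ t i, (V t : 𝓗 →L[ℂ] 𝓗) (b i) = Complex.exp (Complex.I * l i * t) • b i)
    {φ ψ : 𝓗} (h : ∀ i, b.repr φ i = Complex.I * l i * b.repr ψ i) (t : ℝ) :
    (V t : 𝓗 →L[ℂ] 𝓗) ψ = ψ + ∫ s in (0 : ℝ)..t, (V s : 𝓗 →L[ℂ] 𝓗) φ := by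
  refine repr_ext b fun i => ?_
  have hderiv : ∀ s : ℝ, HasDerivAt (fun s : ℝ => b.repr ((V s : 𝓗 →L[ℂ] 𝓗) ψ) i)
      (b.repr ((V s : 𝓗 →L[ℂ] 𝓗) φ) i) s := fun s => by
    simp only [repr_diagGroup hV, h]
    convert! (((Complex.ofRealCLM.hasDerivAt (x := s)).const_mul
      (Complex.I * l i)).cexp.mul_const (b.repr ψ i)) using 1
    simp [mul_assoc]
  have hcont : Continuous fun s : ℝ => b.repr ((V s : 𝓗 →L[ℂ] 𝓗) φ) i := by
    simp only [b.repr_apply_apply]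
    exact continuous_const.inner (hVg.continuous φ)
  have hint := intervalIntegral.integral_eq_sub_of_hasDerivAt (fun s _ => hderiv s)
    (hcont.intervalIntegrable 0 t)
  have hcomm := (innerSL ℂ (b i)).intervalIntegral_comp_comm
    ((hVg.continuous φ).intervalIntegrable (μ := volume) 0 t)
  simp only [innerSL_apply_apply, ← b.repr_apply_apply] at hcomm
  rw [map_add, lp.coeFn_add, Pi.add_apply, ← hcomm, hint, hVg.map_zero]
  simp

theorem generator_eq_I_smul_diagOp (hVg : IsUnitaryGroup V)
    (hV : ∀ t i, (V t : 𝓗 →L[ℂ] 𝓗) (b i) = Complex.exp (Complex.I * l i * t) • b i) :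
    generator V = Complex.I • diagOp b l := by
  refine LinearPMap.eq_of_eq_graph ?_
  ext ⟨ψ, φ⟩
  rw [mem_generator_graph_iff, mem_I_smul_diagOp_graph_iff]
  constructor
  · intro h i
    have hcoord : HasDerivAt (fun t : ℝ => b.repr ((V t : 𝓗 →L[ℂ] 𝓗) ψ) i) (b.repr φ i) 0 := by
      simp only [b.repr_apply_apply]
      exact ((innerSL ℂ (b i)).restrictScalars ℝ).hasFDerivAt.comp_hasDerivAt 0 h
    simp only [repr_diagGroup hV] at hcoord
    exact hcoord.unique (hasDerivAt_exp_smul (Complex.I * l i) (b.repr ψ i))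
  · intro h
    have hderiv := ((hVg.continuous φ).integral_hasStrictDerivAt 0 0).hasDerivAt.const_add ψ
    rw [hVg.map_zero] at hderiv
    exact hderiv.congr_of_eventuallyEq
      (Eventually.of_forall (eq_add_integral_diagGroup hVg hV h))

theorem apply_eq_exp_smul_of_generator_eq (hV : IsUnitaryGroup V)
    (hgen : generator V = Complex.I • diagOp b l) (t : ℝ) (i : ι) :
    (V t : 𝓗 →L[ℂ] 𝓗) (b i) = Complex.exp (Complex.I * l i * t) • b i := by
  refine apply_eq_exp_smul_of_hasDerivAt hV.map_add ?_ t
  rw [← mem_generator_graph_iff, hgen, mem_I_smul_graph_iff, smul_smul, ← mul_assoc]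
  simpa using hilbertBasis_mem_diagOp_graph b l i

theorem eq_of_generator_eq_I_smul_diagOp (hV : IsUnitaryGroup V) (hW : IsUnitaryGroup W)
    (hVgen : generator V = Complex.I • diagOp b l) (hWgen : generator W = Complex.I • diagOp b l) :
    V = W :=
  funext fun t => Subtype.ext (clm_ext_hilbertBasis b fun i => by
    rw [apply_eq_exp_smul_of_generator_eq hV hVgen, apply_eq_exp_smul_of_generator_eq hW hWgen])

theorem isUnitaryGroup_expGroup {A : 𝓗 →ₗ.[ℂ] 𝓗} (hW : IsUnitaryGroup W) (hA : generator W = A) :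
    IsUnitaryGroup (expGroup A) ∧ generator (expGroup A) = A := by
  have hex : ∃ V : ℝ → unitary (𝓗 →L[ℂ] 𝓗), IsUnitaryGroup V ∧ generator V = A := ⟨W, hW, hA⟩
  rw [expGroup, dif_pos hex]
  exact hex.choose_spec

end Diagonal

/-! ### Spectral measures of diagonal operators -/

section DiagonalSpectral

variable {𝓗 : Type*} [NormedAddCommGroup 𝓗] [InnerProductSpace ℂ 𝓗] [CompleteSpace 𝓗]

namespace SpectralMeasure

variable (E : SpectralMeasure 𝓗)

theorem scalarMeasure_apply (ψ : 𝓗) {B : Set ℝ} (hB : MeasurableSet B) :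
    E.scalarMeasure ψ B = ENNReal.ofReal (‖E.proj B ψ‖ ^ 2) := by
  rw [SpectralMeasure.scalarMeasure, Measure.ofMeasurable_apply _ hB]

instance (ψ : 𝓗) : IsFiniteMeasure (E.scalarMeasure ψ) :=
  ⟨by rw [E.scalarMeasure_apply ψ MeasurableSet.univ]; exact ENNReal.ofReal_lt_top⟩

end SpectralMeasure

theorem integrable_id_of_lintegral_sq_lt_top {ρ : Measure ℝ} [IsFiniteMeasure ρ]
    (h : ∫⁻ x, ENNReal.ofReal (x ^ 2) ∂ρ < ∞) : Integrable (fun x : ℝ => x) ρ := by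
  have hsq : Integrable (fun x : ℝ => x ^ 2) ρ := by
    refine ⟨by fun_prop, ?_⟩
    rwa [hasFiniteIntegral_iff_ofReal (Eventually.of_forall fun x => sq_nonneg x)]
  have hL2 : MemLp (fun x : ℝ => x) 2 ρ := (memLp_two_iff_integrable_sq (by fun_prop)).2 hsq
  exact hL2.integrable (by norm_num)

variable {ι : Type*} (b : HilbertBasis ι ℂ 𝓗) (l : ι → ℝ)

/-- The projection onto the closed span of the `b i` with `l i ∈ B`. -/
def diagProj (B : Set ℝ) : 𝓗 →L[ℂ] 𝓗 :=
  (Submodule.span ℂ (b '' (l ⁻¹' B))).topologicalClosure.starProjection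

theorem diagProj_apply_hilbertBasis (B : Set ℝ) (i : ι) :
    diagProj b l B (b i) = (l ⁻¹' B).indicator b i := by
  by_cases h : i ∈ l ⁻¹' B
  · rw [Set.indicator_of_mem h]
    exact Submodule.starProjection_eq_self_iff.2
      (Submodule.le_topologicalClosure _ (Submodule.subset_span ⟨i, h, rfl⟩))
  · rw [Set.indicator_of_notMem h]
    refine (Submodule.starProjection_apply_eq_zero_iff _).2 ?_
    rw [Submodule.orthogonal_closure, Submodule.mem_orthogonal']
    intro φ hφ
    have hle : Submodule.span ℂ (b '' (l ⁻¹' B)) ≤ (ℂ ∙ b i)ᗮ := by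
      rw [Submodule.span_le]
      rintro _ ⟨j, hj, rfl⟩
      exact Submodule.mem_orthogonal_singleton_iff_inner_right.2
        (b.orthonormal.2 fun hij => h (hij ▸ hj))
    exact Submodule.mem_orthogonal_singleton_iff_inner_right.1 (hle hφ)

theorem isStarProjection_diagProj (B : Set ℝ) : IsStarProjection (diagProj b l B) :=
  isStarProjection_starProjection

theorem repr_diagProj (B : Set ℝ) (ψ : 𝓗) (i : ι) :
    b.repr (diagProj b l B ψ) i = (l ⁻¹' B).indicator (b.repr ψ) i := by
  rw [b.repr_apply_apply, diagProj, ← Submodule.inner_starProjection_left_eq_right, ← diagProj,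
    diagProj_apply_hilbertBasis]
  by_cases h : i ∈ l ⁻¹' B
  · rw [Set.indicator_of_mem h, Set.indicator_of_mem h, b.repr_apply_apply]
  · rw [Set.indicator_of_notMem h, Set.indicator_of_notMem h, inner_zero_left]

theorem hasSum_diagProj (B : Set ℝ) (ψ : 𝓗) :
    HasSum (fun i : l ⁻¹' B => b.repr ψ i • b i) (diagProj b l B ψ) := by
  refine (hasSum_subtype_iff_indicator (f := fun i => b.repr ψ i • b i)).2 ?_
  convert! b.hasSum_repr (diagProj b l B ψ) using 2 with i
  rw [repr_diagProj, Set.indicator_smul_left]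

/-- The spectral measure of the diagonal operator `diagOp b l`. -/
def diagSpectral : SpectralMeasure 𝓗 where
  proj := diagProj b l
  isStarProjection B _ := isStarProjection_diagProj b l B
  proj_empty := clm_ext_hilbertBasis b fun i => by simp [diagProj_apply_hilbertBasis]
  proj_univ := clm_ext_hilbertBasis b fun i => by simp [diagProj_apply_hilbertBasis]
  proj_inter B C _ _ := ContinuousLinearMap.ext fun ψ => repr_ext b fun i => by
    by_cases hB : l i ∈ B <;> by_cases hC : l i ∈ C <;> simp [repr_diagProj, hB, hC]
  hasSum_iUnion B _ hB ψ := by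
    have hdisjoint : Pairwise (Function.onFun Disjoint fun n => l ⁻¹' B n) :=
      fun m n hmn => (hB hmn).preimage l
    have hunion : HasSum (fun i : ⋃ n, l ⁻¹' B n => b.repr ψ i • b i)
        (diagProj b l (⋃ n, B n) ψ) := by
      rw [← Set.preimage_iUnion]
      exact hasSum_diagProj b l _ ψ
    exact ((Set.unionEqSigmaOfDisjoint hdisjoint).symm.hasSum_iff.2 hunion).sigma
      fun n => hasSum_diagProj b l (B n) ψ

theorem scalarMeasure_diagSpectral (ψ : 𝓗) :
    (diagSpectral b l).scalarMeasure ψ =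
      Measure.sum fun i => ENNReal.ofReal (‖b.repr ψ i‖ ^ 2) • Measure.dirac (l i) := by
  ext B hB
  have hnorm := hasSum_sq_norm_repr b (diagProj b l B ψ)
  rw [SpectralMeasure.scalarMeasure_apply _ _ hB, Measure.sum_apply _ hB]
  change ENNReal.ofReal (‖diagProj b l B ψ‖ ^ 2) = _
  rw [← hnorm.tsum_eq, ENNReal.ofReal_tsum_of_nonneg (fun i => by positivity) hnorm.summable]
  refine tsum_congr fun i => ?_
  rw [repr_diagProj, Measure.smul_apply, Measure.dirac_apply' _ hB]
  by_cases hi : l i ∈ B <;> simp [hi]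

theorem mem_diagOp_domain_iff_lintegral_lt_top {ψ : 𝓗} :
    ψ ∈ (diagOp b l).domain ↔
      ∫⁻ x, ENNReal.ofReal (x ^ 2) ∂((diagSpectral b l).scalarMeasure ψ) < ∞ := by
  have hlint : ∫⁻ x, ENNReal.ofReal (x ^ 2) ∂((diagSpectral b l).scalarMeasure ψ) =
      ∑' i, ENNReal.ofReal (‖(l i : ℂ) * b.repr ψ i‖ ^ 2) := by
    rw [scalarMeasure_diagSpectral, lintegral_sum_measure]
    refine tsum_congr fun i => ?_
    rw [lintegral_smul_measure, lintegral_dirac, smul_eq_mul,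
      ← ENNReal.ofReal_mul (by positivity), norm_mul, mul_pow, mul_comm, Complex.norm_real,
      Real.norm_eq_abs, sq_abs]
  rw [hlint]
  change Memℓp (fun i => (l i : ℂ) * b.repr ψ i) 2 ↔ _
  rw [memℓp_two_iff]
  constructor
  · intro h
    rw [← ENNReal.ofReal_tsum_of_nonneg (fun i => by positivity) h]
    exact ENNReal.ofReal_lt_top
  · intro h
    simpa [ENNReal.toReal_ofReal, sq_nonneg] using ENNReal.summable_toReal h.ne

theorem inner_diagOp_eq_integral (ψ : (diagOp b l).domain) :
    ⟪(ψ : 𝓗), diagOp b l ψ⟫_ℂ =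
      ((∫ x, x ∂((diagSpectral b l).scalarMeasure (ψ : 𝓗)) : ℝ) : ℂ) := by
  have hint := integrable_id_of_lintegral_sq_lt_top
    ((mem_diagOp_domain_iff_lintegral_lt_top b l).1 ψ.2)
  rw [scalarMeasure_diagSpectral] at hint ⊢
  refine (b.hasSum_inner_mul_inner (ψ : 𝓗) (diagOp b l ψ)).unique ?_
  convert! Complex.hasSum_ofReal.2 (hasSum_integral_measure hint) using 2 with i
  rw [integral_smul_measure, integral_dirac, ENNReal.toReal_ofReal (by positivity),
    ← b.repr_apply_apply, repr_diagOp, ← inner_conj_symm, ← b.repr_apply_apply, mul_left_comm,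
    Complex.conj_mul', smul_eq_mul]
  push_cast
  ring

theorem isSpectralMeasureOf_diagSpectral :
    (diagSpectral b l).IsSpectralMeasureOf (diagOp b l) :=
  ⟨fun _ => mem_diagOp_domain_iff_lintegral_lt_top b l, inner_diagOp_eq_integral b l⟩

theorem commute_diagProj_starProjection {K : Submodule ℂ 𝓗} [K.HasOrthogonalProjection]
    (hK : ∀ i, b i ∈ K ∨ b i ∈ Kᗮ) (B : Set ℝ) : Commute (diagProj b l B) K.starProjection := by
  refine clm_ext_hilbertBasis b fun i => ?_
  have hP : diagProj b l B (b i) = b i ∨ diagProj b l B (b i) = 0 := by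
    rw [diagProj_apply_hilbertBasis]
    by_cases hi : i ∈ l ⁻¹' B <;> simp [hi]
  have hQ : K.starProjection (b i) = b i ∨ K.starProjection (b i) = 0 :=
    (hK i).imp Submodule.starProjection_eq_self_iff.2
      (Submodule.starProjection_apply_eq_zero_iff _).2
  rcases hP with hP | hP <;> rcases hQ with hQ | hQ <;> simp [hP, hQ]

end DiagonalSpectral

/-! ### Operators whose spectral projections reduce finite-dimensional subspaces -/

section Reducing

variable {𝓗 : Type*} [NormedAddCommGroup 𝓗] [InnerProductSpace ℂ 𝓗]

theorem apply_mem_of_commute_starProjection {K : Submodule ℂ 𝓗} [K.HasOrthogonalProjection]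
    {P : 𝓗 →L[ℂ] 𝓗} (h : Commute P K.starProjection) {ψ : 𝓗} (hψ : ψ ∈ K) : P ψ ∈ K := by
  have hcomm : P (K.starProjection ψ) = K.starProjection (P ψ) := DFunLike.congr_fun h.eq ψ
  rw [Submodule.starProjection_eq_self_iff.2 hψ] at hcomm
  rw [hcomm]
  exact Submodule.starProjection_apply_mem _ _

variable [CompleteSpace 𝓗]

namespace SpectralMeasure

variable {E : SpectralMeasure 𝓗} {K : Submodule ℂ 𝓗} {T : 𝓗 →ₗ.[ℂ] 𝓗}

theorem inner_proj_proj (E : SpectralMeasure 𝓗) (φ ψ : 𝓗) {B C : Set ℝ} (hB : MeasurableSet B)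
    (hC : MeasurableSet C) : ⟪E.proj B φ, E.proj C ψ⟫_ℂ = ⟪φ, E.proj (B ∩ C) ψ⟫_ℂ := by
  rw [E.proj_inter B C hB hC]
  exact ContinuousLinearMap.isSelfAdjoint_iff_isSymmetric.1
    (E.isStarProjection B hB).isSelfAdjoint φ (E.proj C ψ)

theorem measurableSet_floor_preimage (n : ℤ) : MeasurableSet (Int.floor ⁻¹' {n} : Set ℝ) :=
  Int.measurable_floor (measurableSet_singleton n)

theorem finite_floor_proj_ne_zero [FiniteDimensional ℂ K]
    (hK : ∀ B, MeasurableSet B → ∀ ψ ∈ K, E.proj B ψ ∈ K) {ψ : 𝓗} (hψ : ψ ∈ K) :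
    {n : ℤ | E.proj (Int.floor ⁻¹' {n}) ψ ≠ 0}.Finite := by
  let v : {n : ℤ | E.proj (Int.floor ⁻¹' {n}) ψ ≠ 0} → K :=
    fun n => ⟨E.proj (Int.floor ⁻¹' {(n : ℤ)}) ψ, hK _ (measurableSet_floor_preimage n) ψ hψ⟩
  have hv : LinearIndependent ℂ v := by
    refine linearIndependent_of_ne_zero_of_inner_eq_zero
      (fun n h => n.2 (congrArg Subtype.val h)) fun m n hmn => ?_
    have hdisjoint : Disjoint (Int.floor ⁻¹' {(m : ℤ)} : Set ℝ) (Int.floor ⁻¹' {(n : ℤ)}) :=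
      Disjoint.preimage _ (Set.disjoint_singleton.2 (Subtype.coe_ne_coe.2 hmn))
    refine (E.inner_proj_proj ψ ψ (measurableSet_floor_preimage m)
      (measurableSet_floor_preimage n)).trans ?_
    rw [hdisjoint.inter_eq, E.proj_empty, zero_apply, inner_zero_right]
  exact Set.finite_coe_iff.1 hv.finite

theorem lintegral_sq_lt_top_of_mem [FiniteDimensional ℂ K]
    (hK : ∀ B, MeasurableSet B → ∀ ψ ∈ K, E.proj B ψ ∈ K) {ψ : 𝓗} (hψ : ψ ∈ K) :
    ∫⁻ x, ENNReal.ofReal (x ^ 2) ∂(E.scalarMeasure ψ) < ∞ := by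
  let N : Set ℤ := {n | E.proj (Int.floor ⁻¹' {n}) ψ ≠ 0}
  have hfloor_mem : ∀ᵐ x ∂(E.scalarMeasure ψ), ⌊x⌋ ∈ N := by
    refine measure_mono_null (t := ⋃ n : (Nᶜ : Set ℤ), Int.floor ⁻¹' {(n : ℤ)})
      (fun x hx => Set.mem_iUnion.2 ⟨⟨⌊x⌋, hx⟩, rfl⟩) (measure_iUnion_null fun n => ?_)
    have hn : E.proj (Int.floor ⁻¹' {(n : ℤ)}) ψ = 0 := not_not.1 n.2
    rw [E.scalarMeasure_apply ψ (measurableSet_floor_preimage n), hn]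
    simp
  obtain ⟨C, hC⟩ :=
    ((finite_floor_proj_ne_zero hK hψ).image fun n : ℤ => ((|n| : ℝ) + 1) ^ 2).bddAbove
  calc ∫⁻ x, ENNReal.ofReal (x ^ 2) ∂(E.scalarMeasure ψ)
      ≤ ∫⁻ _, ENNReal.ofReal C ∂(E.scalarMeasure ψ) := by
        refine lintegral_mono_ae (hfloor_mem.mono fun x hx => ENNReal.ofReal_le_ofReal ?_)
        have habs : |x| ≤ |(⌊x⌋ : ℝ)| + 1 := by
          rw [← sub_le_iff_le_add']
          refine (abs_sub_abs_le_abs_sub x ⌊x⌋).trans ?_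
          rw [Int.self_sub_floor, abs_of_nonneg (Int.fract_nonneg x)]
          exact (Int.fract_lt_one x).le
        rw [← sq_abs x]
        exact (pow_le_pow_left₀ (abs_nonneg x) habs 2).trans (hC ⟨⌊x⌋, hx, rfl⟩)
    _ < ∞ := by
        rw [lintegral_const]
        exact ENNReal.mul_lt_top ENNReal.ofReal_lt_top (measure_lt_top _ _)

theorem scalarMeasure_add {φ ψ : 𝓗} (h : ∀ B, MeasurableSet B → ⟪φ, E.proj B ψ⟫_ℂ = 0) :
    E.scalarMeasure (φ + ψ) = E.scalarMeasure φ + E.scalarMeasure ψ := by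
  ext B hB
  have horthogonal : ⟪E.proj B φ, E.proj B ψ⟫_ℂ = 0 := by
    rw [E.inner_proj_proj φ ψ hB hB, Set.inter_self, h B hB]
  rw [Measure.add_apply, E.scalarMeasure_apply _ hB, E.scalarMeasure_apply _ hB,
    E.scalarMeasure_apply _ hB, ← ENNReal.ofReal_add (by positivity) (by positivity), map_add]
  congr 1
  simpa only [sq] using norm_add_sq_eq_norm_sq_add_norm_sq_of_inner_eq_zero _ _ horthogonal

namespace IsSpectralMeasureOf

theorem inner_add_inner_eq_zero (hE : E.IsSpectralMeasureOf T) (φ ψ : T.domain)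
    (h : ∀ B, MeasurableSet B → ⟪(φ : 𝓗), E.proj B ψ⟫_ℂ = 0) :
    ⟪(φ : 𝓗), T ψ⟫_ℂ + ⟪(ψ : 𝓗), T φ⟫_ℂ = 0 := by
  have hq := hE.2 (φ + ψ)
  rw [Submodule.coe_add, E.scalarMeasure_add h,
    integral_add_measure (integrable_id_of_lintegral_sq_lt_top ((hE.1 φ).1 φ.2))
      (integrable_id_of_lintegral_sq_lt_top ((hE.1 ψ).1 ψ.2)),
    Complex.ofReal_add, ← hE.2 φ, ← hE.2 ψ, T.map_add] at hq
  simp only [inner_add_left, inner_add_right] at hq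
  linear_combination hq

theorem inner_eq_zero (hE : E.IsSpectralMeasureOf T) (φ ψ : T.domain)
    (h : ∀ B, MeasurableSet B → ⟪(φ : 𝓗), E.proj B ψ⟫_ℂ = 0) : ⟪(φ : 𝓗), T ψ⟫_ℂ = 0 := by
  have hre := hE.inner_add_inner_eq_zero φ ψ h
  have him := hE.inner_add_inner_eq_zero φ (Complex.I • ψ) fun B hB => by
    rw [Submodule.coe_smul, map_smul, inner_smul_right, h B hB, mul_zero]
  rw [T.map_smul, Submodule.coe_smul, inner_smul_right, inner_smul_left, Complex.conj_I] at him
  have hdiff : ⟪(φ : 𝓗), T ψ⟫_ℂ - ⟪(ψ : 𝓗), T φ⟫_ℂ = 0 :=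
    (mul_eq_zero.1 (by linear_combination him)).resolve_left Complex.I_ne_zero
  linear_combination (hre + hdiff) / 2

theorem mem_domain (hE : E.IsSpectralMeasureOf T) [FiniteDimensional ℂ K]
    (hK : ∀ B, MeasurableSet B → Commute (E.proj B) K.starProjection) {ψ : 𝓗} (hψ : ψ ∈ K) :
    ψ ∈ T.domain :=
  (hE.1 ψ).2 (lintegral_sq_lt_top_of_mem
    (fun B hB _ hφ => apply_mem_of_commute_starProjection (hK B hB) hφ) hψ)

end IsSpectralMeasureOf

end SpectralMeasure

/-! ### Block-diagonal selfadjoint operators -/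

variable {ι : Type*} {S : ι → Submodule ℂ 𝓗}

/-- The operator `T` acts on the summands `S i` by the bounded operators `h i`. -/
def HasBlocks (T : 𝓗 →ₗ.[ℂ] 𝓗) (h : ∀ i, S i →L[ℂ] S i) : Prop :=
  ∀ i (ψ : S i), ((ψ : 𝓗), (h i ψ : 𝓗)) ∈ T.graph

omit [CompleteSpace 𝓗] in
theorem HasBlocks.blocks_unique {T : 𝓗 →ₗ.[ℂ] 𝓗} {h h' : ∀ i, S i →L[ℂ] S i}
    (hT : HasBlocks T h) (hT' : HasBlocks T h') : h = h' :=
  funext fun i => ContinuousLinearMap.ext fun ψ =>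
    Subtype.ext (T.mem_graph_snd_inj' (hT i ψ) (hT' i ψ) rfl)

/-- The members of the Hilbert basis `c` lie in the summands `S i` and are eigenvectors, with real
eigenvalues `l`, of the blocks `h i`. -/
def IsEigenbasis {κ : Type*} (c : HilbertBasis κ ℂ 𝓗) (h : ∀ i, S i →L[ℂ] S i) (l : κ → ℝ) :
    Prop :=
  ∀ p, ∃ i, ∃ v : S i, c p = v ∧ h i v = (l p : ℂ) • v

section Eigenbasis

variable {κ : Type*} {c : HilbertBasis κ ℂ 𝓗} {h : ∀ i, S i →L[ℂ] S i} {l : κ → ℝ}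

theorem HasBlocks.eq_diagOp {T : 𝓗 →ₗ.[ℂ] 𝓗} (hT : HasBlocks T h) (hTsa : IsSelfAdjoint T)
    (hc : IsEigenbasis c h l) : T = diagOp c l := by
  refine ChargeControl.eq_diagOp c l hTsa fun p => ?_
  obtain ⟨i, v, hv, hl⟩ := hc p
  simpa only [hl, hv, Submodule.coe_smul] using hT i v

theorem IsEigenbasis.mem_or_mem_orthogonal (hc : IsEigenbasis c h l)
    (hS : IsHilbertSum ℂ (fun i => S i) fun i => (S i).subtypeₗᵢ) (p : κ) (i : ι) :
    c p ∈ S i ∨ c p ∈ (S i)ᗮ := by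
  obtain ⟨j, v, hv, -⟩ := hc p
  rw [hv]
  rcases eq_or_ne j i with rfl | hji
  · exact Or.inl v.2
  · exact Or.inr ((Submodule.mem_orthogonal' _ _).2
      fun φ hφ => hS.OrthogonalFamily hji v ⟨φ, hφ⟩)

variable [∀ i, CompleteSpace (S i)]
  (hS : IsHilbertSum ℂ (fun i => S i) fun i => (S i).subtypeₗᵢ)

include hS in
theorem IsEigenbasis.repr_block (hc : IsEigenbasis c h l) (hh : ∀ i, IsSelfAdjoint (h i)) (p : κ)
    {i : ι} (ψ : S i) : c.repr (h i ψ : 𝓗) p = l p * c.repr (ψ : 𝓗) p := by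
  obtain ⟨j, v, hv, hl⟩ := hc p
  rw [c.repr_apply_apply, c.repr_apply_apply, hv]
  rcases eq_or_ne j i with rfl | hji
  · have hsymm : ⟪h j v, ψ⟫_ℂ = ⟪v, h j ψ⟫_ℂ :=
      ContinuousLinearMap.isSelfAdjoint_iff_isSymmetric.1 (hh j) v ψ
    rw [hl, inner_smul_left, Complex.conj_ofReal] at hsymm
    exact hsymm.symm
  · have horthogonal : ∀ φ : S i, ⟪(v : 𝓗), (φ : 𝓗)⟫_ℂ = 0 := hS.OrthogonalFamily hji v
    rw [horthogonal, horthogonal, mul_zero]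

include hS in
theorem IsEigenbasis.hasBlocks_diagOp (hc : IsEigenbasis c h l) (hh : ∀ i, IsSelfAdjoint (h i)) :
    HasBlocks (diagOp c l) h :=
  fun _ ψ => (mem_diagOp_graph_iff c l).2 fun p => hc.repr_block hS hh p ψ

end Eigenbasis

section FiniteDimensionalBlocks

variable [∀ i, FiniteDimensional ℂ (S i)]
  (hS : IsHilbertSum ℂ (fun i => S i) fun i => (S i).subtypeₗᵢ)

include hS in
theorem exists_hilbertBasis_of_blocks {α : ι → Type*} [∀ i, Fintype (α i)]
    (b : ∀ i, OrthonormalBasis (α i) ℂ (S i)) :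
    ∃ c : HilbertBasis (Σ i, α i) ℂ 𝓗, ∀ p, c p = (b p.1 p.2 : 𝓗) := by
  let v : (Σ i, α i) → 𝓗 := fun p => (b p.1 p.2 : 𝓗)
  have hv : Orthonormal ℂ v := hS.OrthogonalFamily.orthonormal_sigma_orthonormal
    fun i => (b i).orthonormal
  suffices hbot : (Submodule.span ℂ (Set.range v))ᗮ = ⊥ from
    ⟨HilbertBasis.mkOfOrthogonalEqBot hv hbot, fun p => by
      rw [HilbertBasis.coe_mkOfOrthogonalEqBot]⟩
  rw [Submodule.eq_bot_iff]
  intro ψ hψ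
  have hinner : ∀ p, ⟪v p, ψ⟫_ℂ = 0 :=
    fun p => (Submodule.mem_orthogonal _ _).1 hψ _ (Submodule.subset_span ⟨p, rfl⟩)
  refine ext_orthogonalProjectionOnto hS fun i => ?_
  rw [map_zero]
  refine InnerProductSpace.ext_inner_left_basis (𝕜 := ℂ) (b i).toBasis fun j => ?_
  rw [OrthonormalBasis.coe_toBasis, inner_zero_right, Submodule.coe_inner,
    Submodule.coe_orthogonalProjectionOnto_apply, ← Submodule.inner_starProjection_left_eq_right,
    Submodule.starProjection_eq_self_iff.2 (Submodule.coe_mem _)]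
  exact hinner ⟨i, j⟩

variable {h : ∀ i, S i →L[ℂ] S i} {T T' : 𝓗 →ₗ.[ℂ] 𝓗}

include hS in
theorem exists_isEigenbasis (hh : ∀ i, IsSelfAdjoint (h i)) :
    ∃ (c : HilbertBasis (Σ i, Fin (Module.finrank ℂ (S i))) ℂ 𝓗)
      (l : (Σ i, Fin (Module.finrank ℂ (S i))) → ℝ), IsEigenbasis c h l := by
  choose b l hb using fun i => exists_orthonormalBasis_apply_eq_smul (hh i)
  obtain ⟨c, hc⟩ := exists_hilbertBasis_of_blocks hS b
  exact ⟨c, fun p => l p.1 p.2, fun p => ⟨p.1, b p.1 p.2, hc p, hb p.1 p.2⟩⟩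

include hS in
theorem exists_isSelfAdjoint_hasBlocks (hh : ∀ i, IsSelfAdjoint (h i)) :
    ∃ T : 𝓗 →ₗ.[ℂ] 𝓗, IsSelfAdjoint T ∧ HasBlocks T h := by
  obtain ⟨c, l, hc⟩ := exists_isEigenbasis hS hh
  exact ⟨diagOp c l, isSelfAdjoint_diagOp c l, hc.hasBlocks_diagOp hS hh⟩

include hS in
theorem HasBlocks.unique (hT : HasBlocks T h) (hT' : HasBlocks T' h)
    (hh : ∀ i, IsSelfAdjoint (h i)) (hTsa : IsSelfAdjoint T) (hTsa' : IsSelfAdjoint T') :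
    T = T' := by
  obtain ⟨c, l, hc⟩ := exists_isEigenbasis hS hh
  rw [hT.eq_diagOp hTsa hc, hT'.eq_diagOp hTsa' hc]

include hS in
theorem HasBlocks.exists_spectralMeasure (hT : HasBlocks T h) (hh : ∀ i, IsSelfAdjoint (h i))
    (hTsa : IsSelfAdjoint T) :
    ∃ E : SpectralMeasure 𝓗, E.IsSpectralMeasureOf T ∧
      ∀ B, MeasurableSet B → ∀ i, Commute (E.proj B) (S i).starProjection := by
  obtain ⟨c, l, hc⟩ := exists_isEigenbasis hS hh
  rw [hT.eq_diagOp hTsa hc]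
  exact ⟨diagSpectral c l, isSpectralMeasureOf_diagSpectral c l, fun B _ i =>
    commute_diagProj_starProjection c l (fun p => hc.mem_or_mem_orthogonal hS p i) B⟩

namespace SpectralMeasure.IsSpectralMeasureOf

variable {E : SpectralMeasure 𝓗}

include hS in
theorem apply_mem (hE : E.IsSpectralMeasureOf T)
    (hcomm : ∀ B, MeasurableSet B → ∀ i, Commute (E.proj B) (S i).starProjection) {i : ι}
    (ψ : T.domain) (hψ : (ψ : 𝓗) ∈ S i) : T ψ ∈ S i := by
  have hzero : ∀ j ≠ i, (S j).orthogonalProjectionOnto (T ψ) = 0 := by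
    intro j hj
    refine Submodule.orthogonalProjectionOnto_eq_zero_iff.2 ((Submodule.mem_orthogonal _ _).2 ?_)
    intro φ hφ
    refine hE.inner_eq_zero ⟨φ, hE.mem_domain (hcomm · · j) hφ⟩ ψ fun B hB => ?_
    exact hS.OrthogonalFamily hj ⟨φ, hφ⟩
      ⟨E.proj B ψ, apply_mem_of_commute_starProjection (hcomm B hB i) hψ⟩
  have hsum := hasSum_orthogonalProjectionOnto hS (T ψ)
  rw [hsum.unique (hasSum_single i fun j hj => by rw [hzero j hj, ZeroMemClass.coe_zero])]
  exact Submodule.coe_mem _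

include hS in
theorem exists_hasBlocks (hE : E.IsSpectralMeasureOf T)
    (hcomm : ∀ B, MeasurableSet B → ∀ i, Commute (E.proj B) (S i).starProjection) :
    ∃ h : ∀ i, S i →L[ℂ] S i, (∀ i, IsSelfAdjoint (h i)) ∧ HasBlocks T h := by
  have hdom : ∀ i, S i ≤ T.domain := fun i ψ hψ => hE.mem_domain (hcomm · · i) hψ
  let h : ∀ i, S i →L[ℂ] S i := fun i => LinearMap.toContinuousLinearMap <|
    (T.toFun ∘ₗ Submodule.inclusion (hdom i)).codRestrict (S i)
      fun ψ => hE.apply_mem hS hcomm ⟨ψ, hdom i ψ.2⟩ ψ.2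
  refine ⟨h, fun i => ?_, fun i ψ => T.mem_graph ⟨ψ, hdom i ψ.2⟩⟩
  rw [ContinuousLinearMap.isSelfAdjoint_iff_isSymmetric,
    LinearMap.isSymmetric_iff_inner_map_self_real]
  intro ψ
  have hreal : ⟪ψ, h i ψ⟫_ℂ = _ := hE.2 ⟨ψ, hdom i ψ.2⟩
  rw [inner_conj_symm, ContinuousLinearMap.coe_coe, hreal, ← inner_conj_symm, hreal,
    Complex.conj_ofReal]

end SpectralMeasure.IsSpectralMeasureOf

end FiniteDimensionalBlocks

end Reducing

/-! ### Exponentials of block-diagonal operators -/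

section SkewFamily

variable {ι : Type*} {E : ι → Type*} [∀ i, NormedAddCommGroup (E i)]
  [∀ i, InnerProductSpace ℂ (E i)] [∀ i, FiniteDimensional ℂ (E i)]

/-- The Lie algebra of families of skew-adjoint operators on finite-dimensional spaces. It is a
type of its own, rather than a subalgebra, to keep the search for its structure short. -/
def SkewFamily (E : ι → Type*) [∀ i, NormedAddCommGroup (E i)]
    [∀ i, InnerProductSpace ℂ (E i)] [∀ i, FiniteDimensional ℂ (E i)] : Type _ :=
  skewAdjointLie (∀ i, E i →L[ℂ] E i)

namespace SkewFamily

instance : LieRing (SkewFamily E) :=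
  inferInstanceAs (LieRing (skewAdjointLie (∀ i, E i →L[ℂ] E i)))

instance : LieAlgebra ℝ (SkewFamily E) :=
  inferInstanceAs (LieAlgebra ℝ (skewAdjointLie (∀ i, E i →L[ℂ] E i)))

theorem coe_add (a b : SkewFamily E) (i : ι) : (a + b).1 i = a.1 i + b.1 i := rfl

theorem coe_smul_apply (t : ℝ) (a : SkewFamily E) (i : ι) (v : E i) :
    (t • a).1 i v = (t : ℂ) • a.1 i v := by
  rw [Complex.coe_smul]
  rfl

theorem coe_lie (a b : SkewFamily E) (i : ι) :
    (⁅a, b⁆ : SkewFamily E).1 i = a.1 i * b.1 i - b.1 i * a.1 i := rfl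

/-- The family `i h` for a family `h` of selfadjoint operators. -/
def ofSelfAdjoint (h : ∀ i, E i →L[ℂ] E i) (hh : ∀ i, IsSelfAdjoint (h i)) : SkewFamily E :=
  ⟨fun i => Complex.I • h i, funext fun i =>
    IsSelfAdjoint.smul_mem_skewAdjoint (by simp [skewAdjoint.mem_iff]) (hh i)⟩

theorem coe_ofSelfAdjoint (h : ∀ i, E i →L[ℂ] E i) (hh : ∀ i, IsSelfAdjoint (h i)) :
    (ofSelfAdjoint h hh).1 = fun i => Complex.I • h i := rfl

theorem isSelfAdjoint_neg_I_smul (a : SkewFamily E) (i : ι) :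
    IsSelfAdjoint ((-Complex.I) • a.1 i) :=
  isSelfAdjoint_smul_of_mem_skewAdjoint (r := -Complex.I) (by simp [skewAdjoint.mem_iff])
    (congrFun a.2 i)

/-- The family of the exponentials of the members of a family. -/
def exp (a : SkewFamily E) : ∀ i, unitary (E i →L[ℂ] E i) :=
  expFamily (A := fun i => E i →L[ℂ] E i) a

theorem coe_exp (a : SkewFamily E) (i : ι) :
    (a.exp i : E i →L[ℂ] E i) = NormedSpace.exp (a.1 i) := rfl

theorem exp_zero : (0 : SkewFamily E).exp = 1 :=
  expFamily_zero (A := fun i => E i →L[ℂ] E i)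

theorem exp_add_smul (s t : ℝ) (a : SkewFamily E) :
    ((s + t) • a).exp = (s • a).exp * (t • a).exp :=
  expFamily_add_smul (A := fun i => E i →L[ℂ] E i) s t a

theorem continuous_exp_smul (a : SkewFamily E) : Continuous fun t : ℝ => (t • a).exp :=
  continuous_expFamily_smul (A := fun i => E i →L[ℂ] E i) a

theorem exp_surjective : Function.Surjective (exp : SkewFamily E → _) := fun u => by
  choose a ha hau using fun i => exists_exp_eq_of_mem_unitary (u i).2
  exact ⟨⟨a, funext ha⟩, funext fun i => Subtype.ext (hau i)⟩

theorem exp_mem_of_mem_lieSpan {G : Subgroup (∀ i, unitary (E i →L[ℂ] E i))}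
    (hG : IsClosed (G : Set (∀ i, unitary (E i →L[ℂ] E i)))) {s : Set (SkewFamily E)}
    (hs : ∀ a ∈ s, ∀ t : ℝ, (t • a).exp ∈ G) {a : SkewFamily E}
    (ha : a ∈ LieSubalgebra.lieSpan ℝ _ s) : a.exp ∈ G :=
  expFamily_mem_of_mem_lieSpan (A := fun i => E i →L[ℂ] E i) hG hs ha

theorem exists_subgroup_coe_eq_closure_exp (𝔩 : LieSubalgebra ℝ (SkewFamily E)) :
    ∃ G : Subgroup (∀ i, unitary (E i →L[ℂ] E i)),
      (G : Set (∀ i, unitary (E i →L[ℂ] E i))) = closure (exp '' (𝔩 : Set (SkewFamily E))) :=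
  ⟨closureExp (A := fun i => E i →L[ℂ] E i) (fun _ => isDominatingTrace_reTrace) 𝔩, rfl⟩

end SkewFamily

end SkewFamily

section BlockGroup

variable {𝓗 : Type*} [NormedAddCommGroup 𝓗] [InnerProductSpace ℂ 𝓗] {ι : Type*}
  {S : ι → Submodule ℂ 𝓗}

theorem hasBlocks_I_smul_iff {T : 𝓗 →ₗ.[ℂ] 𝓗} {h : ∀ i, S i →L[ℂ] S i} :
    HasBlocks (Complex.I • T) h ↔ HasBlocks T fun i => (-Complex.I) • h i :=
  forall₂_congr fun _ _ => mem_I_smul_graph_iff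

variable [∀ i, FiniteDimensional ℂ (S i)] [CompleteSpace 𝓗]
  (hS : IsHilbertSum ℂ (fun i => S i) fun i => (S i).subtypeₗᵢ)

/-- The one-parameter group of block-diagonal unitaries generated by the operators `a i` on the
summands `S i`. -/
def blockGroup (a : SkewFamily fun i => S i) (t : ℝ) : unitary (𝓗 →L[ℂ] 𝓗) :=
  blockUnitary hS (t • a).exp

theorem isUnitaryGroup_blockGroup (a : SkewFamily fun i => S i) :
    IsUnitaryGroup (blockGroup hS a) where
  map_zero := by rw [blockGroup, zero_smul, SkewFamily.exp_zero, MonoidHom.map_one]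
  map_add s t := by rw [blockGroup, SkewFamily.exp_add_smul, MonoidHom.map_mul]; rfl
  continuous ψ := (continuous_strongTopology_iff.1 (continuous_blockUnitary hS) ψ).comp
    a.continuous_exp_smul

variable {a : SkewFamily fun i => S i}

theorem IsEigenbasis.blockGroup_apply {κ : Type*} {c : HilbertBasis κ ℂ 𝓗} {l : κ → ℝ}
    (hc : IsEigenbasis c (fun i => (-Complex.I) • a.1 i) l) (t : ℝ) (p : κ) :
    (blockGroup hS a t : 𝓗 →L[ℂ] 𝓗) (c p) = Complex.exp (Complex.I * l p * t) • c p := by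
  obtain ⟨i, v, hv, hav⟩ := hc p
  have heigen : (t • a).1 i v = (Complex.I * l p * t) • v := by
    have hav' : a.1 i v = Complex.I • (-Complex.I) • a.1 i v := by
      rw [smul_smul, mul_neg, Complex.I_mul_I, neg_neg, one_smul]
    rw [SkewFamily.coe_smul_apply, hav', ← smul_apply, hav, smul_smul, smul_smul]
    congr 1
    ring
  rw [hv, blockGroup, blockUnitary_apply_of_mem, SkewFamily.coe_exp,
    exp_apply_of_apply_eq_smul heigen, Submodule.coe_smul]

variable {T : 𝓗 →ₗ.[ℂ] 𝓗}

theorem HasBlocks.generator_blockGroup (ha : HasBlocks (Complex.I • T) a.1)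
    (hT : IsSelfAdjoint T) : generator (blockGroup hS a) = Complex.I • T := by
  obtain ⟨c, l, hc⟩ := exists_isEigenbasis hS a.isSelfAdjoint_neg_I_smul
  rw [(hasBlocks_I_smul_iff.1 ha).eq_diagOp hT hc]
  exact generator_eq_I_smul_diagOp (isUnitaryGroup_blockGroup hS a) (hc.blockGroup_apply hS)

theorem HasBlocks.existsUnique_isUnitaryGroup
    (hS : IsHilbertSum ℂ (fun i => S i) fun i => (S i).subtypeₗᵢ)
    (ha : HasBlocks (Complex.I • T) a.1) (hT : IsSelfAdjoint T) :
    ∃! V : ℝ → unitary (𝓗 →L[ℂ] 𝓗), IsUnitaryGroup V ∧ generator V = Complex.I • T := by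
  have hgen := ha.generator_blockGroup hS hT
  refine ⟨blockGroup hS a, ⟨isUnitaryGroup_blockGroup hS a, hgen⟩, fun V hV => ?_⟩
  obtain ⟨c, l, hc⟩ := exists_isEigenbasis hS a.isSelfAdjoint_neg_I_smul
  have hdiag := (hasBlocks_I_smul_iff.1 ha).eq_diagOp hT hc
  rw [hdiag] at hV hgen
  exact eq_of_generator_eq_I_smul_diagOp hV.1 (isUnitaryGroup_blockGroup hS a) hV.2 hgen

theorem HasBlocks.expGroup_eq_blockGroup (ha : HasBlocks (Complex.I • T) a.1)
    (hT : IsSelfAdjoint T) : expGroup (Complex.I • T) = blockGroup hS a :=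
  have hgen := ha.generator_blockGroup hS hT
  (ha.existsUnique_isUnitaryGroup hS hT).unique
    (isUnitaryGroup_expGroup (isUnitaryGroup_blockGroup hS a) hgen)
    ⟨isUnitaryGroup_blockGroup hS a, hgen⟩

end BlockGroup

/-! ### Dynamical groups of block-diagonal generators -/

section Dynamical

variable {𝓗 : Type*} [NormedAddCommGroup 𝓗] [InnerProductSpace ℂ 𝓗] [CompleteSpace 𝓗]
  {κ : Type*}

theorem isClosed_dynamicalGroup (A : κ → 𝓗 →ₗ.[ℂ] 𝓗) :
    IsClosed[strongTopology 𝓗] (dynamicalGroup A : Set (unitary (𝓗 →L[ℂ] 𝓗))) := by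
  let _ := strongTopology 𝓗
  rw [dynamicalGroup, Subgroup.coe_sInf]
  exact isClosed_biInter fun G hG => hG.1

theorem expGroup_mem_dynamicalGroup (A : κ → 𝓗 →ₗ.[ℂ] 𝓗) (k : κ) (t : ℝ) :
    expGroup (A k) t ∈ dynamicalGroup A :=
  Subgroup.mem_sInf.2 fun _ hG => hG.2 k t

variable {A : κ → 𝓗 →ₗ.[ℂ] 𝓗} {ι : Type*} {S : ι → Submodule ℂ 𝓗}
  [∀ i, FiniteDimensional ℂ (S i)] {b : κ → SkewFamily fun i => S i}
  (hS : IsHilbertSum ℂ (fun i => S i) fun i => (S i).subtypeₗᵢ)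
  (hA : ∀ k, expGroup (A k) = blockGroup hS (b k))
include hA

theorem blockUnitary_exp_mem_dynamicalGroup {a : SkewFamily fun i => S i}
    (ha : a ∈ LieSubalgebra.lieSpan ℝ _ (Set.range b)) :
    blockUnitary hS a.exp ∈ dynamicalGroup A := by
  let _ := strongTopology 𝓗
  have hclosed : IsClosed ((dynamicalGroup A).comap (blockUnitary hS) :
      Set (∀ i, unitary (S i →L[ℂ] S i))) :=
    (isClosed_dynamicalGroup A).preimage (continuous_blockUnitary hS)
  refine SkewFamily.exp_mem_of_mem_lieSpan hclosed ?_ ha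
  rintro _ ⟨k, rfl⟩ t
  have hmem := expGroup_mem_dynamicalGroup A k t
  rwa [hA k] at hmem

theorem closure_blockUnitary_exp_eq_dynamicalGroup :
    closure[strongTopology 𝓗] ((fun a : SkewFamily fun i => S i => blockUnitary hS a.exp) ''
      (LieSubalgebra.lieSpan ℝ _ (Set.range b) : Set (SkewFamily fun i => S i))) =
      (dynamicalGroup A : Set (unitary (𝓗 →L[ℂ] 𝓗))) := by
  let _ := strongTopology 𝓗
  set 𝔩 := LieSubalgebra.lieSpan ℝ _ (Set.range b)
  refine Set.Subset.antisymm (closure_minimal ?_ (isClosed_dynamicalGroup A)) ?_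
  · rintro _ ⟨a, ha, rfl⟩
    exact blockUnitary_exp_mem_dynamicalGroup hS hA ha
  have hemb := isClosedEmbedding_blockUnitary hS
  obtain ⟨G, hG⟩ := SkewFamily.exists_subgroup_coe_eq_closure_exp 𝔩
  have himage : (G.map (blockUnitary hS) : Set (unitary (𝓗 →L[ℂ] 𝓗))) =
      closure ((fun a : SkewFamily fun i => S i => blockUnitary hS a.exp) '' 𝔩) := by
    rw [Subgroup.coe_map, hG, ← hemb.closure_image_eq, Set.image_image]
  rw [← himage]
  refine sInf_le (a := G.map (blockUnitary hS)) ⟨himage ▸ isClosed_closure, fun k t => ?_⟩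
  rw [hA k, ← SetLike.mem_coe, himage]
  exact subset_closure ⟨t • b k, 𝔩.smul_mem t (LieSubalgebra.subset_lieSpan ⟨k, rfl⟩), rfl⟩

end Dynamical

section LieHom

variable {𝓗 : Type*} [NormedAddCommGroup 𝓗] [InnerProductSpace ℂ 𝓗] [CompleteSpace 𝓗]
  {ι : Type*} {S : ι → Submodule ℂ 𝓗} [∀ i, FiniteDimensional ℂ (S i)]
  (hS : IsHilbertSum ℂ (fun i => S i) fun i => (S i).subtypeₗᵢ)

theorem expOp_eq_blockUnitary_exp {A : 𝓗 →ₗ.[ℂ] 𝓗} {a : SkewFamily fun i => S i}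
    (hA : expGroup A = blockGroup hS a) : expOp A = blockUnitary hS a.exp := by
  rw [expOp, hA, blockGroup, one_smul]

variable {L κ : Type*} [LieRing L] [LieAlgebra ℝ L] (f : L →ₗ⁅ℝ⁆ SkewFamily fun i => S i)
  {A : L → 𝓗 →ₗ.[ℂ] 𝓗} (hA : ∀ x, expGroup (A x) = blockGroup hS (f x)) (Q : κ → L)
include hA

theorem expOp_mem_dynamicalGroup {x : L} (hx : x ∈ LieSubalgebra.lieSpan ℝ L (Set.range Q)) :
    expOp (A x) ∈ dynamicalGroup fun k => A (Q k) := by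
  rw [expOp_eq_blockUnitary_exp hS (hA x)]
  refine blockUnitary_exp_mem_dynamicalGroup hS (fun k => hA (Q k)) ?_
  have hfx : f x ∈ (LieSubalgebra.lieSpan ℝ L (Set.range Q)).map f := ⟨x, hx, rfl⟩
  rwa [LieSubalgebra.map_lieSpan, ← Set.range_comp] at hfx

theorem closure_expOp_eq_dynamicalGroup :
    closure[strongTopology 𝓗] ((fun x => expOp (A x)) ''
      (LieSubalgebra.lieSpan ℝ L (Set.range Q) : Set L)) =
      (dynamicalGroup fun k => A (Q k) : Set (unitary (𝓗 →L[ℂ] 𝓗))) := by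
  have hmap : (LieSubalgebra.lieSpan ℝ _ (Set.range fun k => f (Q k)) :
      Set (SkewFamily fun i => S i)) = f '' LieSubalgebra.lieSpan ℝ L (Set.range Q) := by
    rw [show (Set.range fun k => f (Q k)) = f '' Set.range Q from Set.range_comp f Q,
      ← LieSubalgebra.map_lieSpan]
    rfl
  rw [← closure_blockUnitary_exp_eq_dynamicalGroup hS (fun k => hA (Q k)), hmap, Set.image_image]
  simp only [expOp_eq_blockUnitary_exp hS (hA _)]

end LieHom

/-! ### Operators commuting with the charge -/

section Charge

variable {𝓗 : Type*} [NormedAddCommGroup 𝓗] [InnerProductSpace ℂ 𝓗] [CompleteSpace 𝓗]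
  {π : Circle →* unitary (𝓗 →L[ℂ] 𝓗)} [∀ μ : ℤ, FiniteDimensional ℂ (chargeSpace π μ)]
  (hπ : ∀ ψ : 𝓗, Continuous fun z => (π z : 𝓗 →L[ℂ] 𝓗) ψ)

omit [∀ μ : ℤ, FiniteDimensional ℂ (chargeSpace π μ)] in
theorem mem_chargeGroup_iff {U : unitary (𝓗 →L[ℂ] 𝓗)} :
    U ∈ chargeGroup π ↔ ∀ z ψ, (π z : 𝓗 →L[ℂ] 𝓗) ((U : 𝓗 →L[ℂ] 𝓗) ψ) =
      (U : 𝓗 →L[ℂ] 𝓗) ((π z : 𝓗 →L[ℂ] 𝓗) ψ) := by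
  simp only [chargeGroup, Subgroup.mem_centralizer_iff, Set.forall_mem_range, Subtype.ext_iff,
    ContinuousLinearMap.ext_iff]
  rfl

theorem range_blockUnitary :
    (blockUnitary (chargeSpace_isHilbertSum hπ)).range = chargeGroup π := by
  ext U
  rw [mem_range_blockUnitary_iff, mem_chargeGroup_iff]
  constructor
  · intro hU z
    refine DFunLike.congr_fun (clm_ext_of_forall_mem (chargeSpace_isHilbertSum hπ)
      (T := (π z : 𝓗 →L[ℂ] 𝓗) * U) (T' := (U : 𝓗 →L[ℂ] 𝓗) * π z) fun μ ψ hψ => ?_)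
    rw [mul_apply_eq_comp, mul_apply_eq_comp, mem_chargeSpace_iff.1 (hU μ ψ hψ),
      mem_chargeSpace_iff.1 hψ, map_smul]
  · intro hU μ ψ hψ
    rw [mem_chargeSpace_iff] at hψ ⊢
    intro z
    rw [hU, hψ, map_smul]

include hπ in
theorem isClosed_chargeGroup :
    IsClosed[strongTopology 𝓗] (chargeGroup π : Set (unitary (𝓗 →L[ℂ] 𝓗))) := by
  rw [← range_blockUnitary hπ]
  exact isClosed_range_blockUnitary _

include hπ in
theorem exists_hasSum_of_mem_chargeGroup {U : unitary (𝓗 →L[ℂ] 𝓗)} (hU : U ∈ chargeGroup π) :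
    ∃ u : (μ : ℤ) → unitary (chargeSpace π μ →L[ℂ] chargeSpace π μ), ∀ ψ : 𝓗,
      HasSum (fun μ => ((u μ : chargeSpace π μ →L[ℂ] chargeSpace π μ) (component π μ ψ) : 𝓗))
        ((U : 𝓗 →L[ℂ] 𝓗) ψ) := by
  rw [← range_blockUnitary hπ] at hU
  obtain ⟨u, rfl⟩ := hU
  exact ⟨u, hasSum_blockUnitary _ u⟩

include hπ in
theorem existsUnique_chargeGroup_hasSum
    (u : (μ : ℤ) → unitary (chargeSpace π μ →L[ℂ] chargeSpace π μ)) :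
    ∃! U : chargeGroup π, ∀ ψ : 𝓗,
      HasSum (fun μ => ((u μ : chargeSpace π μ →L[ℂ] chargeSpace π μ) (component π μ ψ) : 𝓗))
        (((U : unitary (𝓗 →L[ℂ] 𝓗)) : 𝓗 →L[ℂ] 𝓗) ψ) := by
  have hsum := hasSum_blockUnitary (chargeSpace_isHilbertSum hπ) u
  refine ⟨⟨_, range_blockUnitary hπ ▸ ⟨u, rfl⟩⟩, hsum, fun U hU => ?_⟩
  exact Subtype.ext (Subtype.ext (ContinuousLinearMap.ext fun ψ => (hU ψ).unique (hsum ψ)))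

theorem mem_finiteParticle_iff {ψ : 𝓗} :
    ψ ∈ finiteParticle π ↔ {μ : ℤ | component π μ ψ ≠ 0}.Finite := by
  simp only [ne_eq, ← Submodule.coe_eq_zero]
  rfl

theorem component_of_mem {μ : ℤ} (ψ : chargeSpace π μ) : component π μ (ψ : 𝓗) = ψ :=
  Submodule.orthogonalProjectionOnto_mem_subspace_eq_self ψ

include hπ in
theorem component_of_mem_of_ne {μ ν : ℤ} (hμν : μ ≠ ν) (ψ : chargeSpace π ν) :
    component π μ (ψ : 𝓗) = 0 :=
  orthogonalProjectionOnto_of_mem_of_ne (chargeSpace_isHilbertSum hπ) hμν ψ.2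

include hπ in
theorem finiteParticle_ext {φ ψ : finiteParticle π}
    (h : ∀ μ, component π μ (φ : 𝓗) = component π μ (ψ : 𝓗)) : φ = ψ :=
  Subtype.ext (ext_orthogonalProjectionOnto (chargeSpace_isHilbertSum hπ) h)

include hπ in
theorem chargeSpace_le_finiteParticle (μ : ℤ) : chargeSpace π μ ≤ finiteParticle π := by
  intro ψ hψ
  refine mem_finiteParticle_iff.2 ((Set.finite_singleton μ).subset fun ν hν => ?_)
  by_contra hne
  exact hν (component_of_mem_of_ne hπ hne ⟨ψ, hψ⟩)

section Blocks

variable (h : ∀ μ, chargeSpace π μ →L[ℂ] chargeSpace π μ)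

theorem summable_block (ψ : finiteParticle π) :
    Summable fun μ => (h μ (component π μ ψ) : 𝓗) :=
  summable_of_hasFiniteSupport <| (mem_finiteParticle_iff.1 ψ.2).subset fun μ hμ hzero =>
    hμ (by simp only [hzero, map_zero, ZeroMemClass.coe_zero])

include hπ in
theorem component_tsum_block (ψ : finiteParticle π) (ν : ℤ) :
    component π ν (∑' μ, (h μ (component π μ ψ) : 𝓗)) = h ν (component π ν ψ) := by
  refine ((summable_block h ψ).hasSum.mapL (component π ν)).unique ?_
  convert hasSum_single ν fun μ hμ => component_of_mem_of_ne hπ hμ.symm (h μ (component π μ ψ))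
  exact (component_of_mem _).symm

/-- The operator on the finite particle vectors that acts by `h μ` on the charge `μ` eigenspace. -/
def blockEnd : Module.End ℂ (finiteParticle π) where
  toFun ψ := ⟨∑' μ, (h μ (component π μ ψ) : 𝓗), by
    refine mem_finiteParticle_iff.2 <| (mem_finiteParticle_iff.1 ψ.2).subset fun μ hμ hzero => hμ ?_
    rw [component_tsum_block hπ, hzero, map_zero]⟩
  map_add' φ ψ := Subtype.ext <| by
    simp only [Submodule.coe_add, map_add]
    exact (summable_block h φ).tsum_add (summable_block h ψ)
  map_smul' c ψ := Subtype.ext <| by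
    simp only [Submodule.coe_smul, map_smul, RingHom.id_apply]
    exact (summable_block h ψ).tsum_const_smul c

theorem hasSum_blockEnd (ψ : finiteParticle π) :
    HasSum (fun μ => (h μ (component π μ ψ) : 𝓗)) (blockEnd hπ h ψ : 𝓗) :=
  (summable_block h ψ).hasSum

theorem component_blockEnd (ψ : finiteParticle π) (ν : ℤ) :
    component π ν (blockEnd hπ h ψ : 𝓗) = h ν (component π ν ψ) :=
  component_tsum_block hπ h ψ ν

variable {h} {h' : ∀ μ, chargeSpace π μ →L[ℂ] chargeSpace π μ}

theorem hasSum_blockEnd_iff :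
    (∀ ψ : finiteParticle π, HasSum (fun μ => (h μ (component π μ ψ) : 𝓗))
      (blockEnd hπ h' ψ : 𝓗)) ↔ h' = h := by
  refine ⟨fun hsum => funext fun μ => ContinuousLinearMap.ext fun ψ => ?_, fun heq ψ =>
    heq ▸ hasSum_blockEnd hπ h' ψ⟩
  let φ : finiteParticle π := ⟨ψ, chargeSpace_le_finiteParticle hπ μ ψ.2⟩
  have heq : blockEnd hπ h' φ = blockEnd hπ h φ :=
    Subtype.ext ((hsum φ).unique (hasSum_blockEnd hπ h φ))
  rw [← component_of_mem ψ, ← component_blockEnd hπ h' φ, ← component_blockEnd hπ h φ, heq]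

theorem HasBlocks.mem_graph_blockEnd {T : 𝓗 →ₗ.[ℂ] 𝓗} (hT : HasBlocks T h)
    (ψ : finiteParticle π) : ((ψ : 𝓗), (blockEnd hπ h ψ : 𝓗)) ∈ T.graph := by
  have hpair : HasSum (fun μ => ((component π μ ψ : 𝓗), (h μ (component π μ ψ) : 𝓗)))
      ((ψ : 𝓗), (blockEnd hπ h ψ : 𝓗)) :=
    (hasSum_orthogonalProjectionOnto (chargeSpace_isHilbertSum hπ) (ψ : 𝓗)).prodMk
      (hasSum_blockEnd hπ h ψ)
  have hfinite := mem_finiteParticle_iff.1 ψ.2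
  rw [hpair.unique (hasSum_sum_of_ne_finset_zero (s := hfinite.toFinset) fun μ hμ => ?_)]
  · exact Submodule.sum_mem _ fun μ _ => hT μ _
  have hzero : component π μ (ψ : 𝓗) = 0 := by simpa using hμ
  simp only [hzero, map_zero, ZeroMemClass.coe_zero, Prod.mk_zero_zero]

end Blocks

section BlockEndLie

variable {L : Type*} [LieRing L] [LieAlgebra ℝ L]
  (f : L →ₗ⁅ℝ⁆ SkewFamily fun μ => chargeSpace π μ)

theorem blockEnd_smul_add (t : ℝ) (x y : L) (ψ : finiteParticle π) :
    blockEnd hπ (f (t • x + y)).1 ψ =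
      (t : ℂ) • blockEnd hπ (f x).1 ψ + blockEnd hπ (f y).1 ψ :=
  finiteParticle_ext hπ fun μ => by
    rw [Submodule.coe_add, Submodule.coe_smul, (component π μ).map_add, (component π μ).map_smul]
    simp only [component_blockEnd]
    rw [map_add f, map_smul f, SkewFamily.coe_add, add_apply, SkewFamily.coe_smul_apply]

theorem blockEnd_lie (x y : L) (ψ : finiteParticle π) :
    blockEnd hπ (f ⁅x, y⁆).1 ψ = blockEnd hπ (f x).1 (blockEnd hπ (f y).1 ψ) -
      blockEnd hπ (f y).1 (blockEnd hπ (f x).1 ψ) :=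
  finiteParticle_ext hπ fun μ => by
    rw [AddSubgroupClass.coe_sub, map_sub]
    simp only [component_blockEnd]
    rw [LieHom.map_lie, SkewFamily.coe_lie, sub_apply, mul_apply_eq_comp, mul_apply_eq_comp]

end BlockEndLie

section Commuting

variable {T : 𝓗 →ₗ.[ℂ] 𝓗}

include hπ

theorem CommutesWithCharge.exists_hasBlocks (hT : CommutesWithCharge π T) :
    ∃ h : ∀ μ, chargeSpace π μ →L[ℂ] chargeSpace π μ,
      (∀ μ, IsSelfAdjoint (h μ)) ∧ HasBlocks T h := by
  obtain ⟨E, hE, hcomm⟩ := hT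
  exact hE.exists_hasBlocks (chargeSpace_isHilbertSum hπ) hcomm

theorem hasCore_finiteParticle (hTsa : IsSelfAdjoint T) (hT : CommutesWithCharge π T) :
    T.HasCore (finiteParticle π) := by
  obtain ⟨h, hh, hblocks⟩ := hT.exists_hasBlocks hπ
  obtain ⟨c, l, hc⟩ := exists_isEigenbasis (chargeSpace_isHilbertSum hπ) hh
  have hdom : finiteParticle π ≤ T.domain := fun ψ hψ =>
    LinearPMap.mem_domain_of_mem_graph (hblocks.mem_graph_blockEnd hπ ⟨ψ, hψ⟩)
  rw [hblocks.eq_diagOp hTsa hc] at hdom ⊢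
  refine diagOp_hasCore c l hdom fun p => ?_
  obtain ⟨μ, v, hv, -⟩ := hc p
  rw [hv]
  exact chargeSpace_le_finiteParticle hπ μ v.2

theorem apply_mem_finiteParticle (hT : CommutesWithCharge π T) (ψ : T.domain)
    (hψ : (ψ : 𝓗) ∈ finiteParticle π) : T ψ ∈ finiteParticle π := by
  obtain ⟨h, -, hblocks⟩ := hT.exists_hasBlocks hπ
  rw [T.mem_graph_snd_inj (T.mem_graph ψ) (hblocks.mem_graph_blockEnd hπ ⟨ψ, hψ⟩) rfl]
  exact Submodule.coe_mem _

end Commuting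

section ChargeAlgebra

variable {Q : 𝓗 →ₗ.[ℂ] 𝓗} {a : SkewFamily fun μ => chargeSpace π μ}

include hπ in
theorem exists_skewFamily_hasBlocks (hQ : Q ∈ chargeAlgebra π) :
    ∃ a : SkewFamily fun μ => chargeSpace π μ, HasBlocks Q a.1 := by
  obtain ⟨T, -, hT, rfl⟩ := hQ
  obtain ⟨h, hh, hblocks⟩ := hT.exists_hasBlocks hπ
  refine ⟨.ofSelfAdjoint h hh, hasBlocks_I_smul_iff.2 ?_⟩
  simpa only [SkewFamily.coe_ofSelfAdjoint, smul_smul, neg_mul, Complex.I_mul_I, neg_neg, one_smul]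
    using hblocks

include hπ in
theorem exists_mem_chargeAlgebra_hasBlocks (a : SkewFamily fun μ => chargeSpace π μ) :
    ∃ Q ∈ chargeAlgebra π, HasBlocks Q a.1 := by
  have hS := chargeSpace_isHilbertSum hπ
  have hh := a.isSelfAdjoint_neg_I_smul
  obtain ⟨T, hTsa, hT⟩ := exists_isSelfAdjoint_hasBlocks hS hh
  exact ⟨Complex.I • T, ⟨T, hTsa, hT.exists_spectralMeasure hS hh hTsa, rfl⟩,
    hasBlocks_I_smul_iff.2 hT⟩

include hπ in
theorem HasBlocks.eq_of_mem_chargeAlgebra {Q' : 𝓗 →ₗ.[ℂ] 𝓗} (ha : HasBlocks Q a.1)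
    (ha' : HasBlocks Q' a.1) (hQ : Q ∈ chargeAlgebra π) (hQ' : Q' ∈ chargeAlgebra π) : Q = Q' := by
  obtain ⟨T, hT, -, rfl⟩ := hQ
  obtain ⟨T', hT', -, rfl⟩ := hQ'
  rw [(hasBlocks_I_smul_iff.1 ha).unique (chargeSpace_isHilbertSum hπ) (hasBlocks_I_smul_iff.1 ha')
    a.isSelfAdjoint_neg_I_smul hT hT']

/-- The elements of `𝔲(X)` are the families of skew-adjoint operators on the eigenspaces of the
charge operator. -/
def chargeEquiv : chargeAlgebra π ≃ SkewFamily fun μ => chargeSpace π μ :=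
  Equiv.ofBijective (fun Q => (exists_skewFamily_hasBlocks hπ Q.2).choose) <| by
    have hblocks := fun Q : chargeAlgebra π => (exists_skewFamily_hasBlocks hπ Q.2).choose_spec
    refine ⟨fun Q Q' (heq : Exists.choose _ = Exists.choose _) => ?_, fun a => ?_⟩
    · exact Subtype.ext ((hblocks Q).eq_of_mem_chargeAlgebra hπ (heq ▸ hblocks Q') Q.2 Q'.2)
    · obtain ⟨Q, hQ, ha⟩ := exists_mem_chargeAlgebra_hasBlocks hπ a
      exact ⟨⟨Q, hQ⟩, Subtype.ext ((hblocks ⟨Q, hQ⟩).blocks_unique ha)⟩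

theorem hasBlocks_chargeEquiv (Q : chargeAlgebra π) :
    HasBlocks (Q : 𝓗 →ₗ.[ℂ] 𝓗) (chargeEquiv hπ Q).1 :=
  (exists_skewFamily_hasBlocks hπ Q.2).choose_spec

theorem expGroup_eq_blockGroup (Q : chargeAlgebra π) : expGroup (Q : 𝓗 →ₗ.[ℂ] 𝓗) =
    blockGroup (chargeSpace_isHilbertSum hπ) (chargeEquiv hπ Q) := by
  have hblocks := hasBlocks_chargeEquiv hπ Q
  obtain ⟨T, hT, -, hQ⟩ := Q.2
  rw [hQ] at hblocks ⊢
  exact hblocks.expGroup_eq_blockGroup _ hT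

include hπ in
theorem existsUnique_isUnitaryGroup (hQ : Q ∈ chargeAlgebra π) :
    ∃! V : ℝ → unitary (𝓗 →L[ℂ] 𝓗), IsUnitaryGroup V ∧ generator V = Q := by
  obtain ⟨a, ha⟩ := exists_skewFamily_hasBlocks hπ hQ
  obtain ⟨T, hT, -, rfl⟩ := hQ
  exact ha.existsUnique_isUnitaryGroup (chargeSpace_isHilbertSum hπ) hT

include hπ in
theorem expOp_image_chargeAlgebra :
    expOp '' chargeAlgebra π = (chargeGroup π : Set (unitary (𝓗 →L[ℂ] 𝓗))) := by
  have hsurj : Function.Surjective fun Q => (chargeEquiv hπ Q).exp :=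
    SkewFamily.exp_surjective.comp (chargeEquiv hπ).surjective
  rw [← range_blockUnitary hπ, MonoidHom.coe_range, Set.image_eq_range]
  simp only [expOp_eq_blockUnitary_exp _ (expGroup_eq_blockGroup hπ _)]
  exact hsurj.range_comp _

section SelfAdjointBlocks

variable {h : (μ : ℤ) → chargeSpace π μ →L[ℂ] chargeSpace π μ}

theorem hasSum_I_smul_blockEnd_iff (hh : ∀ μ, IsSelfAdjoint (h μ)) :
    (∀ ψ : finiteParticle π, HasSum (fun μ => Complex.I • (h μ (component π μ ψ) : 𝓗))
      (blockEnd hπ a.1 ψ : 𝓗)) ↔ a = .ofSelfAdjoint h hh :=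
  (hasSum_blockEnd_iff hπ (h := fun μ => Complex.I • h μ)).trans
    ⟨fun heq => Subtype.ext heq, fun heq => congrArg Subtype.val heq⟩

theorem exists_hasSum_I_smul_blockEnd (a : SkewFamily fun μ => chargeSpace π μ) :
    ∃ h : (μ : ℤ) → chargeSpace π μ →L[ℂ] chargeSpace π μ,
      (∀ μ, IsSelfAdjoint (h μ)) ∧ ∀ ψ : finiteParticle π,
        HasSum (fun μ => Complex.I • (h μ (component π μ ψ) : 𝓗)) (blockEnd hπ a.1 ψ : 𝓗) := by
  refine ⟨fun μ => (-Complex.I) • a.1 μ, a.isSelfAdjoint_neg_I_smul,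
    (hasSum_I_smul_blockEnd_iff hπ a.isSelfAdjoint_neg_I_smul).2 ?_⟩
  exact Subtype.ext (by simp [SkewFamily.coe_ofSelfAdjoint, smul_smul])

theorem existsUnique_hasSum_I_smul_blockEnd (hh : ∀ μ, IsSelfAdjoint (h μ)) :
    ∃! Q : chargeAlgebra π, ∀ ψ : finiteParticle π,
      HasSum (fun μ => Complex.I • (h μ (component π μ ψ) : 𝓗))
        (blockEnd hπ (chargeEquiv hπ Q).1 ψ : 𝓗) := by
  simpa only [hasSum_I_smul_blockEnd_iff hπ hh] using (chargeEquiv hπ).bijective.existsUnique _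

theorem hasSum_boundedExp_expOp {Q : chargeAlgebra π} (hh : ∀ μ, IsSelfAdjoint (h μ))
    (hQ : ∀ ψ : finiteParticle π, HasSum (fun μ => Complex.I • (h μ (component π μ ψ) : 𝓗))
      (blockEnd hπ (chargeEquiv hπ Q).1 ψ : 𝓗)) (ψ : 𝓗) :
    HasSum (fun μ => (boundedExp (Complex.I • h μ) (component π μ ψ) : 𝓗))
      ((expOp (Q : 𝓗 →ₗ.[ℂ] 𝓗) : 𝓗 →L[ℂ] 𝓗) ψ) := by
  rw [hasSum_I_smul_blockEnd_iff hπ hh] at hQ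
  rw [expOp_eq_blockUnitary_exp _ (expGroup_eq_blockGroup hπ Q), hQ]
  exact hasSum_blockUnitary _ _ ψ

end SelfAdjointBlocks

end ChargeAlgebra

end Charge

end ChargeControl

end

theorem mainTheorem1 {𝓗 : Type*} [NormedAddCommGroup 𝓗] [InnerProductSpace ℂ 𝓗]
    [CompleteSpace 𝓗] (π : Circle →* unitary (𝓗 →L[ℂ] 𝓗))
    (hπ : ∀ ψ : 𝓗, Continuous fun z => (π z : 𝓗 →L[ℂ] 𝓗) ψ)
    [∀ μ : ℤ, FiniteDimensional ℂ (chargeSpace π μ)] :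
    -- `D_X` is an invariant domain of essential selfadjointness
    (∀ T : 𝓗 →ₗ.[ℂ] 𝓗, IsSelfAdjoint T → CommutesWithCharge π T →
      T.HasCore (finiteParticle π) ∧
        ∀ ψ : T.domain, (ψ : 𝓗) ∈ finiteParticle π → T ψ ∈ finiteParticle π) ∧
    -- restriction of the elements of `𝔲(X)` to `D_X`
    ∃ res : chargeAlgebra π → Module.End ℂ (finiteParticle π),
      (∀ (Q : chargeAlgebra π) (ψ : finiteParticle π),
        ((ψ : 𝓗), (res Q ψ : 𝓗)) ∈ (Q : 𝓗 →ₗ.[ℂ] 𝓗).graph) ∧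
      -- `𝔲(X)` consists exactly of the block diagonal operators with selfadjoint blocks
      (∀ Q : chargeAlgebra π, ∃ h : (μ : ℤ) → chargeSpace π μ →L[ℂ] chargeSpace π μ,
        (∀ μ, IsSelfAdjoint (h μ)) ∧ ∀ ψ : finiteParticle π,
          HasSum (fun μ => Complex.I • (h μ (component π μ ψ) : 𝓗)) (res Q ψ : 𝓗)) ∧
      (∀ h : (μ : ℤ) → chargeSpace π μ →L[ℂ] chargeSpace π μ, (∀ μ, IsSelfAdjoint (h μ)) →
        ∃! Q : chargeAlgebra π, ∀ ψ : finiteParticle π,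
          HasSum (fun μ => Complex.I • (h μ (component π μ ψ) : 𝓗)) (res Q ψ : 𝓗)) ∧
      -- the exponential map is well defined on `𝔲(X)` and is computed block by block
      (∀ Q ∈ chargeAlgebra π, ∃! V : ℝ → unitary (𝓗 →L[ℂ] 𝓗),
        IsUnitaryGroup V ∧ generator V = Q) ∧
      (∀ (Q : chargeAlgebra π) (h : (μ : ℤ) → chargeSpace π μ →L[ℂ] chargeSpace π μ),
        (∀ μ, IsSelfAdjoint (h μ)) →
        (∀ ψ : finiteParticle π,
          HasSum (fun μ => Complex.I • (h μ (component π μ ψ) : 𝓗)) (res Q ψ : 𝓗)) →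
        ∀ ψ : 𝓗, HasSum
          (fun μ => (boundedExp (Complex.I • h μ) (component π μ ψ) : 𝓗))
          ((expOp (Q : 𝓗 →ₗ.[ℂ] 𝓗) : 𝓗 →L[ℂ] 𝓗) ψ)) ∧
      -- it maps `𝔲(X)` onto the strongly closed group `𝒰(X)`
      expOp '' chargeAlgebra π = (chargeGroup π : Set (unitary (𝓗 →L[ℂ] 𝓗))) ∧
      IsClosed[strongTopology 𝓗] (chargeGroup π : Set (unitary (𝓗 →L[ℂ] 𝓗))) ∧
      -- `𝒰(X)` consists exactly of the block diagonal operators with unitary blocks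
      (∀ U ∈ chargeGroup π,
        ∃ u : (μ : ℤ) → unitary (chargeSpace π μ →L[ℂ] chargeSpace π μ), ∀ ψ : 𝓗,
          HasSum (fun μ => ((u μ : chargeSpace π μ →L[ℂ] chargeSpace π μ) (component π μ ψ) : 𝓗))
            ((U : 𝓗 →L[ℂ] 𝓗) ψ)) ∧
      (∀ u : (μ : ℤ) → unitary (chargeSpace π μ →L[ℂ] chargeSpace π μ),
        ∃! U : chargeGroup π, ∀ ψ : 𝓗,
          HasSum (fun μ => ((u μ : chargeSpace π μ →L[ℂ] chargeSpace π μ) (component π μ ψ) : 𝓗))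
            (((U : unitary (𝓗 →L[ℂ] 𝓗)) : 𝓗 →L[ℂ] 𝓗) ψ)) ∧
      -- `𝔲(X)` is a real Lie algebra with the commutator on `D_X` as its bracket
      ∃ (_ : LieRing (chargeAlgebra π)) (_ : LieAlgebra ℝ (chargeAlgebra π)),
        (∀ (a : ℝ) (Q₁ Q₂ : chargeAlgebra π) (ψ : finiteParticle π),
          res (a • Q₁ + Q₂) ψ = (a : ℂ) • res Q₁ ψ + res Q₂ ψ) ∧
        (∀ (Q₁ Q₂ : chargeAlgebra π) (ψ : finiteParticle π),
          res ⁅Q₁, Q₂⁆ ψ = res Q₁ (res Q₂ ψ) - res Q₂ (res Q₁ ψ)) ∧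
        -- the generated Lie algebra exponentiates into, and strongly densely in, the dynamical group
        ∀ (d : ℕ) (Q : Fin d → chargeAlgebra π),
          (∀ A ∈ LieSubalgebra.lieSpan ℝ (chargeAlgebra π) (Set.range Q),
            expOp (A : 𝓗 →ₗ.[ℂ] 𝓗) ∈ dynamicalGroup fun k => (Q k : 𝓗 →ₗ.[ℂ] 𝓗)) ∧
          closure[strongTopology 𝓗]
              ((fun A : chargeAlgebra π => expOp (A : 𝓗 →ₗ.[ℂ] 𝓗)) ''
                (LieSubalgebra.lieSpan ℝ (chargeAlgebra π) (Set.range Q) :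
                  Set (chargeAlgebra π))) =
            (dynamicalGroup fun k => (Q k : 𝓗 →ₗ.[ℂ] 𝓗) : Set (unitary (𝓗 →L[ℂ] 𝓗))) := by
  have hS := chargeSpace_isHilbertSum hπ
  let e := chargeEquiv hπ
  refine ⟨fun T hTsa hT => ⟨hasCore_finiteParticle hπ hTsa hT, apply_mem_finiteParticle hπ hT⟩,
    fun Q => blockEnd hπ (e Q).1, fun Q => (hasBlocks_chargeEquiv hπ Q).mem_graph_blockEnd hπ,
    fun Q => exists_hasSum_I_smul_blockEnd hπ (e Q),
    fun h hh => existsUnique_hasSum_I_smul_blockEnd hπ hh,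
    fun Q hQ => existsUnique_isUnitaryGroup hπ hQ,
    fun Q h hh hQ => hasSum_boundedExp_expOp hπ hh hQ,
    expOp_image_chargeAlgebra hπ, isClosed_chargeGroup hπ,
    fun U hU => exists_hasSum_of_mem_chargeGroup hπ hU, existsUnique_chargeGroup_hasSum hπ,
    e.lieRing, e.lieAlgebra ℝ, ?_⟩
  let _ := e.lieRing
  let _ := e.lieAlgebra ℝ
  let f := (e.lieEquiv ℝ).toLieHom
  have hexp : ∀ Q : chargeAlgebra π, expGroup (Q : 𝓗 →ₗ.[ℂ] 𝓗) = blockGroup hS (f Q) :=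
    expGroup_eq_blockGroup hπ
  exact ⟨blockEnd_smul_add hπ f, blockEnd_lie hπ f, fun _ Q =>
    ⟨fun _ => expOp_mem_dynamicalGroup hS f hexp Q, closure_expOp_eq_dynamicalGroup hS f hexp Q⟩⟩
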